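/- Let $\omega_0=\sum_i dx_i\wedge dy_i$ be the standard symplectic form on $\mathbb R^{2n}$, and for a subspace $\mathcal C$ let $\mathcal C^{\omega}$ be its $\omega_0$-orthogonal complement; $\mathcal C$ is coisotropic if $\mathcal C^{\omega}\subseteq\mathcal C$, and then $\mathcal C/\mathcal C^\omega$ carries the symplectic form induced by $\omega_0$. For $A\in \mathrm{Sp}(2n)$ let $$\rho(A)=(-1)^{m_0}\prod_{\lambda\in\sigma(A)\cap S^1\setminus\{\pm1\}}\lambda^{m_+(\lambda)}\in S^1$$ be the Salamon–Zehnder map, where $m_0$ is the number of pairs $\{\lambda,\lambda^{-1}\}$ of negative real eigenvalues counted with algebraic multiplicity, and $m_+(\lambda)$ is the positive index of inertia of the Hermitian form $\xi\mapsto i\,\omega_0(\bar\xi,\xi)$ on the generalized $\lambda$-eigenspace of $A$ in $\mathbb C^{2n}$. The mean index of a continuous path $\Psi:[0,1]\to \mathrm{Sp}(2n)$ is $\Delta(\Psi)=\alpha(1)-\alpha(0)$, where $\alpha:[0,1]\to\mathbb R$ is continuous with $\rho(\Psi_t)=e^{\pi i\alpha(t)}$. Let $\mathcal C=(\mathcal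 C_t)_{t\in[0,1]}$, $\mathcal C_1=\mathcal C_0$, be a continuous loop of coisotropic subspaces of $(\mathbb R^{2n},\omega_0)$, and let $H_t:\mathcal C_0/\mathcal C_0^\omega\to\mathcal C_t/\mathcal C_t^\omega$ be a continuous path of symplectic linear maps with $H_0=\mathrm{Id}$. A lift of $(\mathcal C,H)$ is a continuous path $\Psi:[0,1]\to\mathrm{Sp}(2n)$ with $\Psi_0=\mathrm{Id}$ and $\Psi_t(\mathcal C_0)=\mathcal C_t$, which induces $H_t$ on $\mathcal C_0/\mathcal C_0^\omega$ for all $t$. The loop is oriented if the spaces $\mathcal C_t$ can be oriented, continuously in $t\in[0,1]$, so that $\mathcal C_0$ and $\mathcal C_1$ have the same orientation. Then: 1. $(\mathcal C,H)$ has a lift; 2. every lift has a well-defined mean index, and $-\Delta(\Psi)$ is the same number for all lifts $\Psi$ of $(\mathcal C,H)$; 3. the coisotropic Maslov index $\mu(\mathcal C,H)$ is well defined, i.e. the following prescription gives exactly one real number. If $\mathcal C$ is oriented, $\mu(\mathcal C,H):=-\Delta(\Psi)$ for any lift $\Psi$ of $(\mathcal C,H)$. If $\mathcal C$ is not oriented,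 $\mu(\mathcal C,H):=\tfrac12\mu(\mathcal C^2,H^2)$, where $(\mathcal C^2,H^2)$ is the (oriented) loop traversed twice: $\mathcal C^2_t=\mathcal C_{2t}$, $H^2_t=H_{2t}$ for $t\le\frac12$, and $\mathcal C^2_t=\mathcal C_{2t-1}$, $H^2_t=H_{2t-1}\circ H_1$ for $t>\frac12$. -/

import Mathlib

open Set Topology

noncomputable section

namespace CoisotropicMaslov

/-! ### Linear symplectic geometry of the standard space -/

/-- The vector space `ℝ²ⁿ = ℝⁿ × ℝⁿ`; the coordinate `x_i` has index `Sum.inl i` and the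
coordinate `y_i` has index `Sum.inr i`. -/
abbrev Vec (n : ℕ) : Type := Fin n ⊕ Fin n → ℝ

/-- The standard symplectic form `ω₀ = dx ∧ dy`, that is
`ω₀(u, v) = ∑ i, (x_i(u) y_i(v) - y_i(u) x_i(v))`, over any commutative ring `R`
(used for `R = ℝ`, and for `R = ℂ` as the complex bilinear extension). -/
def omega (R : Type) [CommRing R] (n : ℕ) :
    (Fin n ⊕ Fin n → R) →ₗ[R] (Fin n ⊕ Fin n → R) →ₗ[R] R :=
  LinearMap.mk₂ R
    (fun u v => ∑ i, (u (Sum.inl i) * v (Sum.inr i) - u (Sum.inr i) * v (Sum.inl i)))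
    (fun u u' v => by
      rw [← Finset.sum_add_distrib]
      exact Finset.sum_congr rfl fun i _ => by simp only [Pi.add_apply]; ring)
    (fun c u v => by
      rw [smul_eq_mul, Finset.mul_sum]
      exact Finset.sum_congr rfl fun i _ => by simp only [Pi.smul_apply, smul_eq_mul]; ring)
    (fun u v v' => by
      rw [← Finset.sum_add_distrib]
      exact Finset.sum_congr rfl fun i _ => by simp only [Pi.add_apply]; ring)
    (fun c u v => by
      rw [smul_eq_mul, Finset.mul_sum]
      exact Finset.sum_congr rfl fun i _ => by simp only [Pi.smul_apply, smul_eq_mul]; ring)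

/-- The symplectic complement `C^ω = {v | ω₀(v, w) = 0 for all w ∈ C}`. -/
def symplComp {n : ℕ} (C : Submodule ℝ (Vec n)) : Submodule ℝ (Vec n) where
  carrier := {v | ∀ w ∈ C, omega ℝ n v w = 0}
  zero_mem' := fun w _ => by simp
  add_mem' := fun {a b} ha hb w hw => by simp [ha w hw, hb w hw]
  smul_mem' := fun c a ha w hw => by simp [ha w hw]

/-- `C` is coisotropic: `C^ω ⊆ C`. -/
def IsCoisotropic {n : ℕ} (C : Submodule ℝ (Vec n)) : Prop := symplComp C ≤ C

/-- The reduced space `C / C^ω`. -/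
abbrev Red {n : ℕ} (C : Submodule ℝ (Vec n)) : Type := C ⧸ (symplComp C).submoduleOf C

/-- The class `[u] ∈ C / C^ω` of `u ∈ C`. -/
abbrev Red.mk {n : ℕ} {C : Submodule ℝ (Vec n)} (u : C) : Red C :=
  Submodule.Quotient.mk u

/-- The form on `C / C^ω` induced by `ω₀`, i.e. `([u], [v]) ↦ ω₀(u, v)`. -/
def redForm {n : ℕ} (C : Submodule ℝ (Vec n)) : Red C →ₗ[ℝ] Red C →ₗ[ℝ] ℝ :=
  Submodule.liftQ _
    { toFun := fun u => Submodule.liftQ _ ((omega ℝ n u).comp C.subtype) (by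
        intro v hv
        have h : omega ℝ n v u = 0 := hv u u.2
        have e : omega ℝ n u v = -omega ℝ n v u := by
          simp only [omega, LinearMap.mk₂_apply, ← Finset.sum_neg_distrib]
          exact Finset.sum_congr rfl fun i _ => by ring
        simp [e, h])
      map_add' := fun u u' => by
        apply Submodule.linearMap_qext
        ext v
        simp
      map_smul' := fun c u => by
        apply Submodule.linearMap_qext
        ext v
        simp }
    (by
      intro u hu
      rw [LinearMap.mem_ker]
      apply Submodule.linearMap_qext
      ext v
      simpa using hu v v.2)

theorem redForm_mk {n : ℕ} (C : Submodule ℝ (Vec n)) (u v : C) :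
    redForm C (Red.mk u) (Red.mk v) = omega ℝ n u v := rfl

/-- The identification of reduced spaces of two equal subspaces, `[u] ↦ [u]`. -/
def redCast {n : ℕ} {C D : Submodule ℝ (Vec n)} (h : C = D) : Red C →ₗ[ℝ] Red D :=
  Submodule.mapQ _ _ (Submodule.inclusion h.le) (by subst h; exact fun _ hx => hx)

/-! ### The Salamon–Zehnder map and the mean index -/

/-- The generalized eigenspace `E_z ⊆ ℂ²ⁿ` of the complexification of a real matrix. -/
def genEigenspace {n : ℕ} (A : Matrix (Fin n ⊕ Fin n) (Fin n ⊕ Fin n) ℝ) (z : ℂ) :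
    Submodule ℂ (Fin n ⊕ Fin n → ℂ) :=
  Module.End.maxGenEigenspace (Matrix.toLin' (A.map (fun r : ℝ => (r : ℂ)))) z

/-- The number `m₊(z)`: the positive index of inertia, on the generalized eigenspace `E_z`,
of the Hermitian form `ξ ↦ i ω₀(ξ̄, ξ)`, i.e. the largest complex dimension of a
subspace of `E_z` on which the form is positive definite. (The sign is the one for which
a unitary map `X + iY` gets the value `det (X + iY)`.) -/
def mPlus {n : ℕ} (A : Matrix (Fin n ⊕ Fin n) (Fin n ⊕ Fin n) ℝ) (z : ℂ) : ℕ :=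
  sSup {d : ℕ | ∃ W : Submodule ℂ (Fin n ⊕ Fin n → ℂ), W ≤ genEigenspace A z ∧
    (∀ ξ ∈ W, ξ ≠ 0 → 0 < (Complex.I * omega ℂ n (star ξ) ξ).re) ∧
    Module.finrank ℂ W = d}

/-- The number `m₀` of pairs `{z, z⁻¹}` of negative real eigenvalues, counted with algebraic
multiplicity: half the number of negative roots of the characteristic polynomial. -/
def mZero {n : ℕ} (A : Matrix (Fin n ⊕ Fin n) (Fin n ⊕ Fin n) ℝ) : ℕ :=
  (A.charpoly.roots.filter (fun r => r < 0)).card / 2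

open Classical in
/-- The Salamon–Zehnder map `ρ(A) = (-1)^{m₀} ∏ z^{m₊(z)}`, the product running over the
eigenvalues `z ∈ S¹ \ {1, -1}` of `A`. -/
def rho {n : ℕ} (A : Matrix (Fin n ⊕ Fin n) (Fin n ⊕ Fin n) ℝ) : ℂ :=
  (-1) ^ mZero A *
    ∏ z ∈ (A.map (fun r : ℝ => (r : ℂ))).charpoly.roots.toFinset.filter
      (fun z => ‖z‖ = 1 ∧ z ≠ 1 ∧ z ≠ -1), z ^ mPlus A z

/-- `Δ(Ψ) = d`: for some continuous `α : [0,1] → ℝ` with `ρ(Ψ_t) = e^{π i α(t)}`, one has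
`d = α(1) - α(0)`. -/
def HasMeanIndex {n : ℕ} (Ψ : ℝ → Matrix (Fin n ⊕ Fin n) (Fin n ⊕ Fin n) ℝ) (d : ℝ) : Prop :=
  ∃ α : ℝ → ℝ, ContinuousOn α (Icc 0 1) ∧
    (∀ t ∈ Icc (0 : ℝ) 1, rho (Ψ t) = Complex.exp (Real.pi * Complex.I * α t)) ∧
    d = α 1 - α 0

/-! ### Loops of coisotropic subspaces

Paths are functions of a real parameter, of which only the values on `[0,1]` matter. -/

/-- `e` is a continuous frame of the family `C` over the set `U` of parameters. -/
def IsFrameOn {n d : ℕ} (C : ℝ → Submodule ℝ (Vec n)) (U : Set ℝ) (e : Fin d → ℝ → Vec n) :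
    Prop :=
  (∀ i, ContinuousOn (e i) U) ∧
    ∀ t ∈ U, LinearIndependent ℝ (fun i => e i t) ∧
      Submodule.span ℝ (Set.range fun i => e i t) = C t

/-- A loop `C_t`, `t ∈ [0,1]`, of coisotropic subspaces. Continuity (as a path in the
Grassmannian) means that continuous frames exist locally. -/
structure IsCoisotropicLoop {n : ℕ} (C : ℝ → Submodule ℝ (Vec n)) : Prop where
  coisotropic : ∀ t ∈ Icc (0 : ℝ) 1, IsCoisotropic (C t)
  continuous : ∀ t ∈ Icc (0 : ℝ) 1, ∃ U ∈ 𝓝[Icc 0 1] t, ∃ d, ∃ e : Fin d → ℝ → Vec n,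
    IsFrameOn C U e
  closed : C 1 = C 0

/-- The loop is oriented: some continuous choice of orientations of the `C_t` (over the interval
`[0,1]`, it is given by a continuous frame) gives the same orientation on `C_1 = C_0`. -/
def IsOriented {n : ℕ} (C : ℝ → Submodule ℝ (Vec n)) : Prop :=
  ∃ d, ∃ e : Fin d → ℝ → Vec n, IsFrameOn C (Icc 0 1) e ∧
    ∃ G : Matrix (Fin d) (Fin d) ℝ, 0 < G.det ∧ ∀ j, e j 1 = ∑ i, G i j • e i 0

/-- A path `H_t : C_0 / C_0^ω → C_t / C_t^ω`, `t ∈ [0,1]`, of symplectic linear maps with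
`H_0 = id`. Continuity means that each `t ↦ H_t x` is a continuous section of the
quotient bundle, i.e. is represented by a continuous section of the `C_t`. -/
structure IsReducedPath {n : ℕ} (C : ℝ → Submodule ℝ (Vec n))
    (H : ∀ t : ℝ, Red (C 0) →ₗ[ℝ] Red (C t)) : Prop where
  symplectic : ∀ t ∈ Icc (0 : ℝ) 1, ∀ x y : Red (C 0),
    redForm (C t) (H t x) (H t y) = redForm (C 0) x y
  continuous : ∀ x : Red (C 0), ∃ w : ℝ → Vec n, ContinuousOn w (Icc 0 1) ∧
    ∀ t ∈ Icc (0 : ℝ) 1, ∃ hw : w t ∈ C t, H t x = Red.mk ⟨w t, hw⟩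
  start : H 0 = LinearMap.id

/-- `Ψ` is a path of symplectic matrices with `Ψ_0 = Id` and `Ψ_t(C_0) = C_t` which induces
`H_t` on `C_0 / C_0^ω`. -/
structure IsLift {n : ℕ} (C : ℝ → Submodule ℝ (Vec n))
    (H : ∀ t : ℝ, Red (C 0) →ₗ[ℝ] Red (C t))
    (Ψ : ℝ → Matrix (Fin n ⊕ Fin n) (Fin n ⊕ Fin n) ℝ) : Prop where
  continuous : ContinuousOn Ψ (Icc 0 1)
  symplectic : ∀ t ∈ Icc (0 : ℝ) 1, Ψ t ∈ Matrix.symplecticGroup (Fin n) ℝ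
  start : Ψ 0 = 1
  map_eq : ∀ t ∈ Icc (0 : ℝ) 1, (C 0).map (Matrix.toLin' (Ψ t)) = C t
  induces : ∀ t ∈ Icc (0 : ℝ) 1, ∀ (u : C 0) (w : C t),
    (w : Vec n) = (Ψ t).mulVec u → H t (Red.mk u) = Red.mk w

/-- The loop traversed twice. -/
def twice {n : ℕ} (C : ℝ → Submodule ℝ (Vec n)) (t : ℝ) : Submodule ℝ (Vec n) :=
  if t ≤ 1 / 2 then C (2 * t) else C (2 * t - 1)

theorem twice_zero {n : ℕ} (C : ℝ → Submodule ℝ (Vec n)) : twice C 0 = C 0 := by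
  simp [twice]

/-- The path of maps of reduced spaces along the loop traversed twice: `H_{2t}` for `t ≤ 1/2`,
and then `H_{2t-1} ∘ H_1`. -/
def twiceRed {n : ℕ} {C : ℝ → Submodule ℝ (Vec n)} (hC : C 1 = C 0)
    (H : ∀ t : ℝ, Red (C 0) →ₗ[ℝ] Red (C t)) (t : ℝ) : Red (twice C 0) →ₗ[ℝ] Red (twice C t) :=
  if ht : t ≤ 1 / 2 then
    redCast (D := twice C t) (by simp only [twice, if_pos ht]) ∘ₗ H (2 * t) ∘ₗ
      redCast (twice_zero C)
  else
    redCast (D := twice C t) (by simp only [twice, if_neg ht]) ∘ₗ H (2 * t - 1) ∘ₗ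
      redCast hC ∘ₗ H 1 ∘ₗ redCast (twice_zero C)

/-- `m` is a value of the Maslov index of the oriented loop `C` with `H`: `m = -Δ(Ψ)` for some
choice of the lift `Ψ`. -/
def IsOrientedMaslovIndex {n : ℕ} (C : ℝ → Submodule ℝ (Vec n))
    (H : ∀ t : ℝ, Red (C 0) →ₗ[ℝ] Red (C t)) (m : ℝ) : Prop :=
  IsOriented C ∧ ∃ Ψ, IsLift C H Ψ ∧ HasMeanIndex Ψ (-m)

/-- `m` is a value of the coisotropic Maslov index `μ(C, H)`: as above if the loop is oriented,
and otherwise half of a value of the Maslov index of the loop traversed twice. -/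
def IsMaslovIndex {n : ℕ} (C : ℝ → Submodule ℝ (Vec n)) (hC : C 1 = C 0)
    (H : ∀ t : ℝ, Red (C 0) →ₗ[ℝ] Red (C t)) (m : ℝ) : Prop :=
  IsOrientedMaslovIndex C H m ∨
    (¬ IsOriented C ∧ IsOrientedMaslovIndex (twice C) (twiceRed hC H) (2 * m))

end CoisotropicMaslov

end

open CoisotropicMaslov

/-!
The proof rests on a description of `ρ` that avoids eigenvalues. Let `G(u, v) = i ω₀(ū, v)` be the
Krein form on `ℂ²ⁿ`, for which a symplectic matrix `A` is an isometry. If `W` is an `A`-invariant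
subspace of dimension `n` with `G ≥ 0` on `W`, then `ρ(A)` is the phase of `det (A | W)`
(`rho_eq_phase_det`). On the unit circle the generalized eigenspace contributes with the
multiplicity `m₊`, the dimension of any maximal semidefinite subspace of it. Off the circle the
multiplicities in `W` of `z` and of its reflection `1 / z̄`, which has the same phase, add up to the
multiplicity of `z`, and `W` has half the multiplicity of the eigenvalue `-1`; after pairing complex
conjugates only the sign `(-1)^{m₀}` of the negative real eigenvalues is left. Such a `W` always exists, and may be chosen to contain a given invariant
semidefinite subspace (`exists_invariant_maximal_nonneg`).

The freedom in the choice of `W` is used twice. First, the pairs of `A` and an orthonormal frame of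
such a `W` form a closed set which is proper over the symplectic group, so `ρ` is continuous
(`continuousOn_rho`) and every path has a mean index. Secondly, let `A` preserve a coisotropic
subspace `C`, and let `Θ_t` be a path from the identity of symplectic maps that preserve `C` and
induce the identity on `C / C^ω`. Choose `W` between the complexifications of `C^ω` and `C`. Since
`Θ_t - 1` maps `C` to `C^ω`, the space `W` is also invariant under `A Θ_t`, and
`det (A Θ_t | W) = det (A | W) det (Θ_t | C^ω)`, where the last factor is real and, by continuity,
positive. So `ρ(A Θ_t)` is constant (`rho_mul_eq`).

For two lifts `Ψ` and `Ψ'`, this applies to `A = Ψ_1` and `Θ = Φ = Ψ⁻¹ Ψ'`. The function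
`ρ(Ψ_s Φ_t)` on the unit square is `ρ(Ψ_s)` on the side `t = 0`, is constant on the side `s = 1`,
and is `ρ(Ψ'_s)` on the diagonal, so the two mean indices agree
(`IsLift.exists_common_meanIndex`).

A lift is constructed from a global frame of `C^ω`, transported together with its dual frame in
`J C^ω`, and from `H_t` on the orthogonal complement of `C^ω` in `C` (`exists_isLift`). Finally, the
loop traversed twice is again a loop of coisotropic subspaces with a path of reduced maps, and it is
oriented because its monodromy, in terms of a frame of `C` with monodromy `M`, is `M²`; this settles
loops that are not oriented.
-/

open CoisotropicMaslov

/-! ### Hermitian forms and invariant semidefinite subspaces -/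

section Hermitian

variable {V : Type*} [AddCommGroup V] [Module ℂ V]

/-- The orthogonal complement of `W` for a sesquilinear form `G`. -/
def sesqPerp (G : V →ₗ⋆[ℂ] V →ₗ[ℂ] ℂ) (W : Submodule ℂ V) : Submodule ℂ V where
  carrier := {v | ∀ w ∈ W, G w v = 0}
  zero_mem' := fun w _ => by simp
  add_mem' := fun {a b} ha hb w hw => by simp [ha w hw, hb w hw]
  smul_mem' := fun c a ha w hw => by simp [ha w hw]

theorem mem_sesqPerp {G : V →ₗ⋆[ℂ] V →ₗ[ℂ] ℂ} {W : Submodule ℂ V} {v : V} :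
    v ∈ sesqPerp G W ↔ ∀ w ∈ W, G w v = 0 := Iff.rfl

/-- `G` is Hermitian. -/
def IsHerm (G : V →ₗ⋆[ℂ] V →ₗ[ℂ] ℂ) : Prop := ∀ u v, G u v = star (G v u)

/-- `G` is positive semidefinite on `W`. -/
def NonnegOn (G : V →ₗ⋆[ℂ] V →ₗ[ℂ] ℂ) (W : Submodule ℂ V) : Prop := ∀ w ∈ W, 0 ≤ (G w w).re

/-- `G` is positive definite on `W`. -/
def PosOn (G : V →ₗ⋆[ℂ] V →ₗ[ℂ] ℂ) (W : Submodule ℂ V) : Prop :=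
  ∀ w ∈ W, w ≠ 0 → 0 < (G w w).re

variable {G : V →ₗ⋆[ℂ] V →ₗ[ℂ] ℂ}

theorem IsHerm.neg (hG : IsHerm G) : IsHerm (-G) := fun u v => by
  simp only [LinearMap.neg_apply, star_neg, ← hG u v]

theorem IsHerm.eq_zero_symm (hG : IsHerm G) {u v : V} (h : G u v = 0) : G v u = 0 := by
  rw [hG, h, star_zero]

theorem sesqPerp_neg (W : Submodule ℂ V) : sesqPerp (-G) W = sesqPerp G W := by
  ext v; simp [mem_sesqPerp]

theorem sesqPerp_anti {U W : Submodule ℂ V} (h : U ≤ W) : sesqPerp G W ≤ sesqPerp G U :=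
  fun _ hv w hw => hv w (h hw)

theorem IsHerm.le_sesqPerp_comm (hG : IsHerm G) {U W : Submodule ℂ V} :
    U ≤ sesqPerp G W ↔ W ≤ sesqPerp G U :=
  ⟨fun h _ hw _ hu => hG.eq_zero_symm (h hu _ hw), fun h _ hu _ hw => hG.eq_zero_symm (h hw _ hu)⟩

theorem finrank_le_finrank_sesqPerp_inf [FiniteDimensional ℂ V] (X Y : Submodule ℂ V) :
    Module.finrank ℂ Y ≤ Module.finrank ℂ (sesqPerp G X ⊓ Y : Submodule ℂ V) +
      Module.finrank ℂ X := by
  let b := Module.finBasis ℂ X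
  let φ : Y →ₗ[ℂ] (Fin (Module.finrank ℂ X) → ℂ) :=
    LinearMap.pi fun i => (G (b i : V)).comp Y.subtype
  have hker : (LinearMap.ker φ).map Y.subtype ≤ sesqPerp G X ⊓ Y := by
    rintro _ ⟨y, hy, rfl⟩
    refine ⟨fun w hw => ?_, y.2⟩
    have h0 : ∀ i, G (b i : V) y = 0 := fun i => congrFun hy i
    have hw' : w = ∑ i, b.repr ⟨w, hw⟩ i • (b i : V) := by
      have := congrArg X.subtype (b.sum_repr ⟨w, hw⟩)
      rw [map_sum] at this
      exact this.symm
    rw [hw']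
    simp [h0]
  have h1 := LinearMap.finrank_range_add_finrank_ker φ
  have h2 : Module.finrank ℂ (LinearMap.range φ) ≤ Module.finrank ℂ X := by
    simpa using Submodule.finrank_le (LinearMap.range φ)
  have h3 := Submodule.finrank_mono hker
  rw [Submodule.finrank_map_subtype_eq] at h3
  omega

/-- The relative dimension formula for orthogonal complements, for a pairing between `X` and `Y`
with trivial left kernel. -/
theorem IsHerm.finrank_sesqPerp_inf [FiniteDimensional ℂ V] (hG : IsHerm G) {X Y : Submodule ℂ V}
    (h : ∀ x ∈ X, (∀ y ∈ Y, G x y = 0) → x = 0) :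
    Module.finrank ℂ (sesqPerp G X ⊓ Y : Submodule ℂ V) + Module.finrank ℂ X =
      Module.finrank ℂ Y := by
  refine le_antisymm ?_ (finrank_le_finrank_sesqPerp_inf X Y)
  set K := sesqPerp G X ⊓ Y with hK
  obtain ⟨Z, hZ⟩ := Submodule.exists_isCompl (K.submoduleOf Y)
  -- `Z` is a complement of `K` in `Y`: it pairs with `X` with trivial kernel
  have h1 := finrank_le_finrank_sesqPerp_inf (G := G) (Z.map Y.subtype) X
  have h2 : sesqPerp G (Z.map Y.subtype) ⊓ X = ⊥ := by
    rw [eq_bot_iff]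
    rintro x ⟨hx, hxX⟩
    refine h x hxX fun y hy => ?_
    have : (⟨y, hy⟩ : Y) ∈ K.submoduleOf Y ⊔ Z := by rw [hZ.sup_eq_top]; trivial
    obtain ⟨k, hk, z, hz, hkz⟩ := Submodule.mem_sup.1 this
    have e : y = (k : V) + z := congrArg Subtype.val hkz.symm
    have hk' : (k : V) ∈ K := hk
    rw [e, map_add, hk'.1 x hxX, hG.eq_zero_symm (hx z ⟨z, hz, rfl⟩), add_zero]
  rw [h2, finrank_bot, zero_add, Submodule.finrank_map_subtype_eq] at h1
  have h3 := Submodule.finrank_add_eq_of_isCompl hZ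
  have h4 : Module.finrank ℂ (K.submoduleOf Y) = Module.finrank ℂ K :=
    (Submodule.submoduleOfEquivOfLe (inf_le_right : K ≤ Y)).finrank_eq
  omega

/-- Null vectors of a semidefinite subspace lie in its radical. -/
theorem IsHerm.eq_zero_of_nonnegOn (hG : IsHerm G) {W : Submodule ℂ V} (hW : NonnegOn G W)
    {w v : V} (hw : w ∈ W) (hv : v ∈ W) (h0 : (G w w).re ≤ 0) : G w v = 0 := by
  have hww : G w w = 0 := by
    apply Complex.ext
    · exact le_antisymm h0 (hW w hw)
    · have := congrArg Complex.im (hG w w)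
      simp at this
      simpa using (by linarith : (G w w).im = 0)
  by_contra ha
  set a := G w v with hadef
  have hva : G v w = star a := hG v w
  have key : ∀ s : ℝ, 0 ≤ (G v v).re - 2 * s * Complex.normSq a := fun s => by
    have := hW (v + (-(s : ℂ) * a) • w) (W.add_mem hv (W.smul_mem _ hw))
    have e : (G (v + (-(s : ℂ) * a) • w) (v + (-(s : ℂ) * a) • w)).re =
        (G v v).re - 2 * s * Complex.normSq a := by
      simp only [map_add, LinearMap.map_smulₛₗ, LinearMap.add_apply, LinearMap.smul_apply,
        smul_eq_mul, hww, hva, ← hadef]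
      simp [Complex.normSq_apply]
      ring
    rwa [e] at this
  have hpos : 0 < Complex.normSq a := Complex.normSq_pos.2 ha
  have := key (((G v v).re + 1) / (2 * Complex.normSq a))
  have e : 2 * (((G v v).re + 1) / (2 * Complex.normSq a)) * Complex.normSq a = (G v v).re + 1 := by
    field_simp
  linarith

theorem IsHerm.finrank_sesqPerp [FiniteDimensional ℂ V] (hG : IsHerm G)
    (hnd : ∀ x, (∀ y, G x y = 0) → x = 0) (W : Submodule ℂ V) :
    Module.finrank ℂ (sesqPerp G W) + Module.finrank ℂ W = Module.finrank ℂ V := by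
  have := hG.finrank_sesqPerp_inf (X := W) (Y := ⊤) (fun x _ h => hnd x fun y => h y trivial)
  rwa [inf_top_eq, finrank_top] at this

theorem IsHerm.sesqPerp_sesqPerp [FiniteDimensional ℂ V] (hG : IsHerm G)
    (hnd : ∀ x, (∀ y, G x y = 0) → x = 0) (W : Submodule ℂ V) :
    sesqPerp G (sesqPerp G W) = W := by
  symm
  apply Submodule.eq_of_le_of_finrank_eq
  · exact hG.le_sesqPerp_comm.1 le_rfl
  · have := hG.finrank_sesqPerp hnd W
    have := hG.finrank_sesqPerp hnd (sesqPerp G W)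
    omega

/-- If `Y` is invariant and not contained in the invariant subspace `R`, then some vector of
`Y` outside `R` is an eigenvector modulo `R`. -/
theorem exists_eigenvector_mod [FiniteDimensional ℂ V] (A : V →ₗ[ℂ] V) {Y R : Submodule ℂ V}
    (hY : ∀ y ∈ Y, A y ∈ Y) (hR : ∀ y ∈ R, A y ∈ R) (h : ¬ Y ≤ R) :
    ∃ y ∈ Y, y ∉ R ∧ ∃ z : ℂ, A y - z • y ∈ R := by
  let B : (V ⧸ R) →ₗ[ℂ] (V ⧸ R) := R.mapQ R A hR
  let Y' : Submodule ℂ (V ⧸ R) := Y.map R.mkQ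
  have hB : ∀ x ∈ Y', B x ∈ Y' := by
    rintro _ ⟨y, hy, rfl⟩
    exact ⟨A y, hY y hy, rfl⟩
  have hnt : Nontrivial Y' := by
    obtain ⟨y, hy, hyR⟩ := Set.not_subset.1 h
    refine ⟨⟨⟨R.mkQ y, y, hy, rfl⟩, 0, fun e => hyR ?_⟩⟩
    simpa using congrArg Subtype.val e
  obtain ⟨z, hz⟩ := Module.End.exists_eigenvalue (K := ℂ) (B.restrict hB)
  obtain ⟨⟨_, y, hy, rfl⟩, hx⟩ := hz.exists_hasEigenvector
  refine ⟨y, hy, fun hyR => hx.2 ?_, z, ?_⟩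
  · ext
    simpa using hyR
  · have := congrArg Subtype.val hx.apply_eq_smul
    rw [← Submodule.Quotient.mk_eq_zero, Submodule.Quotient.mk_sub, sub_eq_zero]
    exact this

theorem NonnegOn.sup_of_orthogonal {X Y : Submodule ℂ V} (hG : IsHerm G) (hX : NonnegOn G X)
    (hY : NonnegOn G Y) (h : X ≤ sesqPerp G Y) : NonnegOn G (X ⊔ Y) := by
  intro v hv
  obtain ⟨x, hx, y, hy, rfl⟩ := Submodule.mem_sup.1 hv
  have h1 := h hx y hy
  have h2 := hG.eq_zero_symm h1
  simp only [map_add, LinearMap.add_apply, h1, h2, add_zero, zero_add, Complex.add_re]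
  exact add_nonneg (hX x hx) (hY y hy)

/-- Extension step for maximal invariant semidefinite subspaces: adding to `W` a semidefinite
subspace `R + ℂ y`, with `y` an eigenvector modulo the null space `R`, all orthogonal to `W`. -/
theorem NonnegOn.extend (hG : IsHerm G) (A : V →ₗ[ℂ] V) {W R : Submodule ℂ V}
    (hW : NonnegOn G W) (hWA : ∀ w ∈ W, A w ∈ W) (hRA : ∀ w ∈ R, A w ∈ R)
    (hRR : R ≤ sesqPerp G R) (hRW : R ≤ sesqPerp G W) {y : V} (hyW : y ∈ sesqPerp G W)
    (hyR : y ∈ sesqPerp G R) (hy : 0 ≤ (G y y).re) {z : ℂ} (hz : A y - z • y ∈ R) :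
    NonnegOn G (W ⊔ (R ⊔ ℂ ∙ y)) ∧ ∀ w ∈ W ⊔ (R ⊔ ℂ ∙ y), A w ∈ W ⊔ (R ⊔ ℂ ∙ y) := by
  have hspan : NonnegOn G (ℂ ∙ y) := by
    intro v hv
    obtain ⟨c, rfl⟩ := Submodule.mem_span_singleton.1 hv
    have e : (G (c • y) (c • y)).re = Complex.normSq c * (G y y).re := by
      have him : (G y y).im = 0 := by
        have := congrArg Complex.im (hG y y)
        simp at this; linarith
      simp [Complex.normSq_apply, him]; ring
    rw [e]
    exact mul_nonneg (Complex.normSq_nonneg c) hy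
  have hR0 : NonnegOn G R := fun r hr => by rw [hRR hr r hr]; simp
  constructor
  · refine hW.sup_of_orthogonal hG (hR0.sup_of_orthogonal hG hspan ?_) ?_
    · rw [hG.le_sesqPerp_comm, Submodule.span_singleton_le_iff_mem]; exact hyR
    · rw [hG.le_sesqPerp_comm]
      exact sup_le hRW ((Submodule.span_singleton_le_iff_mem _ _).2 hyW)
  · intro w hw
    obtain ⟨a, ha, b, hb, rfl⟩ := Submodule.mem_sup.1 hw
    obtain ⟨r, hr, s, hs, rfl⟩ := Submodule.mem_sup.1 hb
    obtain ⟨c, rfl⟩ := Submodule.mem_span_singleton.1 hs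
    have e : A (a + (r + c • y)) = A a + ((A r + c • (A y - z • y)) + (c * z) • y) := by
      simp only [map_add, map_smul, smul_sub, mul_smul]; abel
    rw [e]
    exact Submodule.add_mem_sup (hWA a ha) (Submodule.add_mem_sup
      (R.add_mem (hRA r hr) (R.smul_mem c hz)) (Submodule.smul_mem _ _
        (Submodule.mem_span_singleton_self y)))

theorem exists_maximal_submodule [FiniteDimensional ℂ V] {P : Submodule ℂ V → Prop}
    {L : Submodule ℂ V} (hL : P L) : ∃ W, P W ∧ L ≤ W ∧ ∀ W', P W' → W ≤ W' → W' = W := by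
  obtain ⟨W, ⟨hW, hLW⟩, hmax⟩ := (wellFounded_gt (α := Submodule ℂ V)).has_min
    {W | P W ∧ L ≤ W} ⟨L, hL, le_rfl⟩
  refine ⟨W, hW, hLW, fun W' hW' h => ?_⟩
  by_contra hne
  exact hmax W' ⟨hW', hLW.trans h⟩ (lt_of_le_of_ne h (Ne.symm hne))

theorem injective_of_isometry (hnd : ∀ x, (∀ y, G x y = 0) → x = 0) {A : V →ₗ[ℂ] V}
    (hA : ∀ u v, G (A u) (A v) = G u v) : Function.Injective A := by
  rw [← LinearMap.ker_eq_bot, LinearMap.ker_eq_bot']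
  intro x hx
  exact hnd x fun y => by rw [← hA, hx]; simp

/-- The orthogonal complement of an invariant subspace of an isometry is invariant. -/
theorem sesqPerp_invariant [FiniteDimensional ℂ V] {A : V →ₗ[ℂ] V}
    (hA : ∀ u v, G (A u) (A v) = G u v) (hinj : Function.Injective A)
    {W : Submodule ℂ V} (hW : ∀ w ∈ W, A w ∈ W) : ∀ v ∈ sesqPerp G W, A v ∈ sesqPerp G W := by
  intro v hv w hw
  -- `A` maps `W` onto itself, being injective
  have : W.map A = W := Submodule.eq_of_le_of_finrank_eq (by rintro _ ⟨w, hw, rfl⟩; exact hW w hw)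
    (Submodule.equivMapOfInjective A hinj W).symm.finrank_eq
  rw [← this] at hw
  obtain ⟨u, hu, rfl⟩ := hw
  rw [hA, hv u hu]

/-- An invariant semidefinite subspace of an isometry extends to a maximal semidefinite subspace
which is still invariant; maximality is expressed by `G ≤ 0` on the orthogonal complement. -/
theorem exists_invariant_maximal_nonneg [FiniteDimensional ℂ V] (hG : IsHerm G)
    (hnd : ∀ x, (∀ y, G x y = 0) → x = 0) {A : V →ₗ[ℂ] V} (hA : ∀ u v, G (A u) (A v) = G u v)
    {L : Submodule ℂ V} (hL : NonnegOn G L) (hLA : ∀ w ∈ L, A w ∈ L) :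
    ∃ W, L ≤ W ∧ (∀ w ∈ W, A w ∈ W) ∧ NonnegOn G W ∧ NonnegOn (-G) (sesqPerp G W) := by
  have hinj := injective_of_isometry hnd hA
  obtain ⟨W, ⟨hW, hWA⟩, hLW, hWmax⟩ := exists_maximal_submodule
    (P := fun W => NonnegOn G W ∧ ∀ w ∈ W, A w ∈ W) ⟨hL, hLA⟩
  obtain ⟨U, ⟨hU, hUA, hUW⟩, -, hUmax⟩ := exists_maximal_submodule
    (P := fun U => NonnegOn (-G) U ∧ (∀ w ∈ U, A w ∈ U) ∧ U ≤ sesqPerp G W) (L := ⊥)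
    ⟨fun w hw => by simp [(Submodule.mem_bot ℂ).1 hw],
      fun w hw => by simp [(Submodule.mem_bot ℂ).1 hw], bot_le⟩
  refine ⟨W, hLW, hWA, hW, ?_⟩
  set Z := W ⊔ U with hZ
  have hZA : ∀ w ∈ Z, A w ∈ Z := fun w hw => by
    obtain ⟨a, ha, b, hb, rfl⟩ := Submodule.mem_sup.1 hw
    rw [map_add]; exact Submodule.add_mem_sup (hWA a ha) (hUA b hb)
  set Y := sesqPerp G Z with hYdef
  have hYA := sesqPerp_invariant (G := G) hA hinj hZA
  set R := Y ⊓ Z with hRdef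
  have hRA : ∀ w ∈ R, A w ∈ R := fun w hw => ⟨hYA w hw.1, hZA w hw.2⟩
  have hRR : R ≤ sesqPerp G R := fun r hr s hs => hr.1 s hs.2
  have hYW : Y ≤ sesqPerp G W := sesqPerp_anti le_sup_left
  have hYU : Y ≤ sesqPerp G U := sesqPerp_anti le_sup_right
  have hRY : R ≤ Y := inf_le_left
  have hYR : ∀ y ∈ Y, y ∈ sesqPerp G R := fun y hy => sesqPerp_anti inf_le_right hy
  -- `Z` contains its orthogonal complement, as otherwise `W` or `U` could be enlarged
  have hYZ : Y ≤ Z := by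
    by_contra hcon
    have hcon' : ¬ Y ≤ R := fun h => hcon (h.trans inf_le_right)
    obtain ⟨y, hy, hyR, z, hz⟩ := exists_eigenvector_mod A hYA hRA hcon'
    have hyZ : y ∉ Z := fun h => hyR ⟨hy, h⟩
    have hymem : ∀ X : Submodule ℂ V, y ∈ X ⊔ (R ⊔ ℂ ∙ y) := fun X =>
      Submodule.mem_sup_right (Submodule.mem_sup_right (Submodule.mem_span_singleton_self y))
    rcases le_total 0 (G y y).re with h0 | h0
    · have := hWmax _ (hW.extend hG A hWA hRA hRR (hRY.trans hYW) (hYW hy) (hYR y hy) h0 hz)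
        le_sup_left
      exact hyZ (Submodule.mem_sup_left (this ▸ hymem W))
    · have h1 := hU.extend hG.neg A hUA hRA (by rwa [sesqPerp_neg])
        (by rw [sesqPerp_neg]; exact hRY.trans hYU) (by rw [sesqPerp_neg]; exact hYU hy)
        (by rw [sesqPerp_neg]; exact hYR y hy) (by simpa using h0) hz
      have := hUmax _ ⟨h1.1, h1.2, sup_le hUW (sup_le (hRY.trans hYW)
        ((Submodule.span_singleton_le_iff_mem _ _).2 (hYW hy)))⟩ le_sup_left
      exact hyZ (Submodule.mem_sup_right (this ▸ hymem U))
  have hYY : Y ≤ sesqPerp G Y := sesqPerp_anti hYZ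
  have hYW' : Y ≤ W := by
    have h0 : NonnegOn G Y := fun r hr => by rw [hYY hr r hr]; simp
    have := hWmax (W ⊔ Y) ⟨hW.sup_of_orthogonal hG h0 (hG.le_sesqPerp_comm.1 hYW),
      fun w hw => by
        obtain ⟨a, ha, b, hb, rfl⟩ := Submodule.mem_sup.1 hw
        rw [map_add]; exact Submodule.add_mem_sup (hWA a ha) (hYA b hb)⟩ le_sup_left
    exact le_sup_right.trans this.le
  have hYU' : Y ≤ U := by
    have h0 : NonnegOn (-G) Y := fun r hr => by
      rw [LinearMap.neg_apply, LinearMap.neg_apply, hYY hr r hr]; simp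
    have := hUmax (U ⊔ Y) ⟨hU.sup_of_orthogonal hG.neg h0
      (by rw [sesqPerp_neg]; exact hG.le_sesqPerp_comm.1 hYU),
      fun w hw => by
        obtain ⟨a, ha, b, hb, rfl⟩ := Submodule.mem_sup.1 hw
        rw [map_add]; exact Submodule.add_mem_sup (hUA a ha) (hYA b hb),
      sup_le hUW hYW⟩ le_sup_left
    exact le_sup_right.trans this.le
  intro v hv
  have hvZ : v ∈ Z := by
    rw [← hG.sesqPerp_sesqPerp hnd Z]
    exact sesqPerp_anti hYW' hv
  obtain ⟨w, hw, u, hu, rfl⟩ := Submodule.mem_sup.1 hvZ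
  have hwY : w ∈ Y := by
    have h1 : w ∈ sesqPerp G W := by
      have := Submodule.sub_mem _ hv (hUW hu)
      simpa using this
    intro t ht
    obtain ⟨a, ha, b, hb, rfl⟩ := Submodule.mem_sup.1 ht
    rw [map_add, LinearMap.add_apply, h1 a ha, hG.eq_zero_symm (hUW hb w hw), add_zero]
  exact hU _ (U.add_mem (hYU' hwY) hu)

/-- On a nondegenerate subspace `E`, every maximal semidefinite subspace (one with `G ≤ 0` on
its orthogonal complement) has the dimension of a maximal positive definite subspace. -/
theorem finrank_eq_sSup_posOn [FiniteDimensional ℂ V] (hG : IsHerm G) {E W : Submodule ℂ V}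
    (hE : ∀ x ∈ E, (∀ y ∈ E, G x y = 0) → x = 0) (hWE : W ≤ E) (hW : NonnegOn G W)
    (hW' : NonnegOn (-G) (sesqPerp G W ⊓ E)) :
    Module.finrank ℂ W =
      sSup {d : ℕ | ∃ P : Submodule ℂ V, P ≤ E ∧ PosOn G P ∧ Module.finrank ℂ P = d} := by
  have hsplit : ∀ {X Y : Submodule ℂ V}, X ≤ E → Y ≤ E → X ⊓ Y = ⊥ →
      Module.finrank ℂ X + Module.finrank ℂ Y ≤ Module.finrank ℂ E := fun {X Y} hX hY h => by
    have h1 := Submodule.finrank_sup_add_finrank_inf_eq X Y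
    rw [h, finrank_bot] at h1
    have h2 := Submodule.finrank_mono (sup_le hX hY)
    omega
  have hub : ∀ P : Submodule ℂ V, P ≤ E → PosOn G P → Module.finrank ℂ P ≤ Module.finrank ℂ W := by
    intro P hPE hP
    have h1 := hsplit hPE (inf_le_right : sesqPerp G W ⊓ E ≤ E) (by
      rw [eq_bot_iff]
      rintro x ⟨hx, hx'⟩
      by_contra hx0
      have h1 := hP x hx hx0
      have h2 := hW' x hx'
      simp at h2
      linarith)
    have h2 := finrank_le_finrank_sesqPerp_inf (G := G) W E
    omega
  obtain ⟨P, ⟨hP, hPE⟩, -, hPmax⟩ := exists_maximal_submodule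
    (P := fun P => PosOn G P ∧ P ≤ E) (L := ⊥)
    ⟨fun w hw h0 => absurd ((Submodule.mem_bot ℂ).1 hw) h0, bot_le⟩
  -- the orthogonal complement of a maximal positive subspace is negative definite
  have hN : NonnegOn (-G) (sesqPerp G P ⊓ E) := by
    intro v hv
    by_contra hcon
    have hpos : 0 < (G v v).re := by simpa using hcon
    have hvv : (G v v).im = 0 := by
      have := congrArg Complex.im (hG v v)
      simp at this; linarith
    have hvP : v ∈ P := by
      have := hPmax (P ⊔ ℂ ∙ v) ⟨fun w hw hw0 => by
        obtain ⟨p, hp, s, hs, rfl⟩ := Submodule.mem_sup.1 hw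
        obtain ⟨c, rfl⟩ := Submodule.mem_span_singleton.1 hs
        have h1 : G p v = 0 := hv.1 p hp
        have h2 := hG.eq_zero_symm h1
        have e : (G (p + c • v) (p + c • v)).re = (G p p).re + Complex.normSq c * (G v v).re := by
          simp [h1, h2, Complex.normSq_apply, hvv]; ring
        rw [e]
        by_cases hp0 : p = 0
        · have hc : c ≠ 0 := by rintro rfl; simp [hp0] at hw0
          subst hp0
          simpa using mul_pos (Complex.normSq_pos.2 hc) hpos
        · exact add_pos_of_pos_of_nonneg (hP p hp hp0)
            (mul_nonneg (Complex.normSq_nonneg c) hpos.le),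
        sup_le hPE ((Submodule.span_singleton_le_iff_mem _ _).2 hv.2)⟩ le_sup_left
      exact this ▸ Submodule.mem_sup_right (Submodule.mem_span_singleton_self v)
    rw [hv.1 v hvP] at hpos
    simp at hpos
  have hlb : Module.finrank ℂ W ≤ Module.finrank ℂ P := by
    have h1 := hsplit hWE (inf_le_right : sesqPerp G P ⊓ E ≤ E) (by
      rw [eq_bot_iff]
      rintro x ⟨hxW, hx⟩
      have hneg : ∀ y ∈ sesqPerp G P ⊓ E, G x y = 0 := fun y hy => by
        have := hG.neg.eq_zero_of_nonnegOn hN hx hy (by simpa using hW x hxW)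
        simpa using this
      refine hE x hx.2 fun y hy => ?_
      -- `E` is the sum of `P` and its orthogonal complement in `E`
      have hsum : P ⊔ (sesqPerp G P ⊓ E) = E := by
        apply Submodule.eq_of_le_of_finrank_le (sup_le hPE inf_le_right)
        have h1 := Submodule.finrank_sup_add_finrank_inf_eq P (sesqPerp G P ⊓ E)
        have h3 : P ⊓ (sesqPerp G P ⊓ E) = ⊥ := by
          rw [eq_bot_iff]
          rintro p ⟨hp, hp'⟩
          by_contra hp0
          have := hP p hp hp0
          rw [hp'.1 p hp] at this
          simp at this
        rw [h3, finrank_bot] at h1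
        have h2 := finrank_le_finrank_sesqPerp_inf (G := G) P E
        omega
      rw [← hsum] at hy
      obtain ⟨p, hp, q, hq, rfl⟩ := Submodule.mem_sup.1 hy
      rw [map_add, hneg q hq, hG.eq_zero_symm (hx.1 p hp), add_zero])
    have h2 := finrank_le_finrank_sesqPerp_inf (G := G) P E
    omega
  have hPW := hub P hPE hP
  symm
  apply le_antisymm
  · refine csSup_le (Set.nonempty_of_mem ⟨P, hPE, hP, rfl⟩) ?_
    rintro d ⟨Q, hQE, hQ, rfl⟩
    exact hub Q hQE hQ
  · refine hlb.trans (le_csSup ⟨Module.finrank ℂ W, ?_⟩ ⟨P, hPE, hP, rfl⟩)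
    rintro d ⟨Q, hQE, hQ, rfl⟩
    exact hub Q hQE hQ

end Hermitian

/-! ### Generalized eigenspaces of an isometry -/

section Isometry

variable {V : Type*} [AddCommGroup V] [Module ℂ V]
  {G : V →ₗ⋆[ℂ] V →ₗ[ℂ] ℂ} {A : Module.End ℂ V}

/-- Generalized eigenspaces of an isometry are orthogonal unless the eigenvalues are reflections
of each other in the unit circle. -/
theorem apply_eq_zero_of_mem_maxGenEigenspace (hA : ∀ u v, G (A u) (A v) = G u v) {z μ : ℂ}
    (hzμ : star z * μ ≠ 1) {u v : V} (hu : u ∈ A.maxGenEigenspace z)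
    (hv : v ∈ A.maxGenEigenspace μ) : G u v = 0 := by
  rw [Module.End.mem_maxGenEigenspace] at hu hv
  obtain ⟨a, ha⟩ := hu
  obtain ⟨b, hb⟩ := hv
  induction hs : a + b using Nat.strong_induction_on generalizing a b u v with
  | _ s ih =>
    rcases Nat.eq_zero_or_pos a with rfl | ha0
    · simp only [pow_zero, Module.End.one_apply] at ha
      simp [ha]
    rcases Nat.eq_zero_or_pos b with rfl | hb0
    · simp only [pow_zero, Module.End.one_apply] at hb
      simp [hb]
    obtain ⟨a, rfl⟩ := Nat.exists_eq_succ_of_ne_zero ha0.ne'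
    obtain ⟨b, rfl⟩ := Nat.exists_eq_succ_of_ne_zero hb0.ne'
    set u' := (A - z • (1 : Module.End ℂ V)) u with hu'
    set v' := (A - μ • (1 : Module.End ℂ V)) v with hv'
    have hau : ((A - z • (1 : Module.End ℂ V)) ^ a) u' = 0 := by
      rw [hu', ← Module.End.mul_apply, ← pow_succ]; exact ha
    have hbv : ((A - μ • (1 : Module.End ℂ V)) ^ b) v' = 0 := by
      rw [hv', ← Module.End.mul_apply, ← pow_succ]; exact hb
    have h1 := ih _ (by omega) a hau (b + 1) hb rfl
    have h2 := ih _ (by omega) (a + 1) ha b hbv rfl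
    have h3 := ih _ (by omega) a hau b hbv rfl
    have eu : A u = z • u + u' := by simp [hu']
    have ev : A v = μ • v + v' := by simp [hv']
    have key := hA u v
    rw [eu, ev] at key
    simp only [map_add, LinearMap.add_apply, LinearMap.map_smulₛₗ, LinearMap.smul_apply,
      smul_eq_mul, h1, h2, h3, RingHom.id_apply, mul_zero, add_zero] at key
    have : (star z * μ - 1) * G u v = 0 := by
      have e : (starRingEnd ℂ) z = star z := rfl
      rw [e] at key
      linear_combination key
    exact (mul_eq_zero.1 this).resolve_left (sub_ne_zero.2 hzμ)

variable [FiniteDimensional ℂ V]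

/-- The form pairs the generalized eigenspaces of `z'` and `z` nondegenerately if
`z' = 1 / conj z`. -/
theorem pairing_maxGenEigenspace (hnd : ∀ x, (∀ y, G x y = 0) → x = 0)
    (hA : ∀ u v, G (A u) (A v) = G u v) {z z' : ℂ} (hz : star z' * z = 1) {x : V}
    (hx : x ∈ A.maxGenEigenspace z') (h : ∀ y ∈ A.maxGenEigenspace z, G x y = 0) : x = 0 := by
  refine hnd x fun y => ?_
  have hle : (⊤ : Submodule ℂ V) ≤ LinearMap.ker (G x) := by
    rw [← Module.End.iSup_maxGenEigenspace_eq_top A, iSup_le_iff]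
    intro μ y hy
    by_cases hμ : star z' * μ = 1
    · have hz0 : star z' ≠ 0 := left_ne_zero_of_mul_eq_one hz
      have : μ = z := mul_left_cancel₀ hz0 (hμ.trans hz.symm)
      exact h y (this ▸ hy)
    · exact apply_eq_zero_of_mem_maxGenEigenspace hA hμ hx hy
  exact hle trivial

/-- For `z' = 1 / z̄`, the form pairs `E_z` perfectly with `E_{z'}`. Hence, within `E_z`, the
complement of an invariant subspace `W` is the complement of its part in `E_{z'}`. -/
theorem finrank_sesqPerp_inf_maxGenEigenspace (hG : IsHerm G)
    (hnd : ∀ x, (∀ y, G x y = 0) → x = 0) (hA : ∀ u v, G (A u) (A v) = G u v)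
    {W : Submodule ℂ V} (hW : ∀ w ∈ W, A w ∈ W) {z z' : ℂ} (hz : star z' * z = 1) :
    sesqPerp G (W ⊓ A.maxGenEigenspace z') ⊓ A.maxGenEigenspace z =
      sesqPerp G W ⊓ A.maxGenEigenspace z ∧
    Module.finrank ℂ (sesqPerp G W ⊓ A.maxGenEigenspace z : Submodule ℂ V) +
      Module.finrank ℂ (W ⊓ A.maxGenEigenspace z' : Submodule ℂ V) =
      Module.finrank ℂ (A.maxGenEigenspace z) := by
  have e : sesqPerp G (W ⊓ A.maxGenEigenspace z') ⊓ A.maxGenEigenspace z =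
      sesqPerp G W ⊓ A.maxGenEigenspace z := by
    refine le_antisymm (le_inf ?_ inf_le_right)
      (inf_le_inf_right _ (sesqPerp_anti inf_le_left))
    rintro v ⟨hv, hvz⟩
    have hle : W ≤ sesqPerp G (ℂ ∙ v) := by
      rw [Submodule.eq_iSup_inf_genEigenspace ⊤ hW (Module.End.iSup_maxGenEigenspace_eq_top A),
        iSup_le_iff]
      rintro μ w hw x hx
      obtain ⟨c, rfl⟩ := Submodule.mem_span_singleton.1 hx
      have : G v w = 0 := by
        by_cases hμ : μ = z'
        · exact hG.eq_zero_symm (hv w (hμ ▸ hw))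
        · refine apply_eq_zero_of_mem_maxGenEigenspace hA (fun h => hμ ?_) hvz hw.2
          have h' : star μ * z = 1 := by
            have := congrArg star h
            simpa [mul_comm] using this
          have hz0 : z ≠ 0 := right_ne_zero_of_mul_eq_one hz
          exact star_injective (mul_right_cancel₀ hz0 (h'.trans hz.symm))
      simp [this]
    intro w hw
    exact hG.eq_zero_symm (hle hw v (Submodule.mem_span_singleton_self v))
  refine ⟨e, ?_⟩
  rw [← e]
  exact hG.finrank_sesqPerp_inf fun x hx h => pairing_maxGenEigenspace hnd hA hz hx.2 h

/-- Off the unit circle, a maximal semidefinite invariant subspace takes up complementary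
dimensions in the generalized eigenspaces of `z` and `1 / conj z`. -/
theorem finrank_inf_add_finrank_inf (hG : IsHerm G)
    (hnd : ∀ x, (∀ y, G x y = 0) → x = 0) (hA : ∀ u v, G (A u) (A v) = G u v)
    {W : Submodule ℂ V} (hW : ∀ w ∈ W, A w ∈ W) (hWp : NonnegOn G W)
    (hWn : NonnegOn (-G) (sesqPerp G W)) {z z' : ℂ} (hz : star z' * z = 1)
    (hz1 : star z * z ≠ 1) :
    Module.finrank ℂ (W ⊓ A.maxGenEigenspace z : Submodule ℂ V) +
      Module.finrank ℂ (W ⊓ A.maxGenEigenspace z' : Submodule ℂ V) =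
      Module.finrank ℂ (A.maxGenEigenspace z) := by
  -- both intersections consist of null vectors of a semidefinite subspace
  have h0 : ∀ v ∈ A.maxGenEigenspace z, G v v = 0 := fun v hv =>
    apply_eq_zero_of_mem_maxGenEigenspace hA hz1 hv hv
  have key : W ⊓ A.maxGenEigenspace z = sesqPerp G W ⊓ A.maxGenEigenspace z := by
    apply le_antisymm
    · rintro v ⟨hv, hvz⟩
      exact ⟨fun w hw => hG.eq_zero_symm
        (hG.eq_zero_of_nonnegOn hWp hv hw (by rw [h0 v hvz]; simp)), hvz⟩
    · rintro v ⟨hv, hvz⟩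
      refine ⟨?_, hvz⟩
      rw [← hG.sesqPerp_sesqPerp hnd W]
      intro w hw
      have := hG.neg.eq_zero_of_nonnegOn hWn hv hw (by simp [h0 v hvz])
      exact hG.eq_zero_symm (by simpa using this)
  rw [key]
  exact (finrank_sesqPerp_inf_maxGenEigenspace hG hnd hA hW hz).2

/-- On the unit circle, a maximal semidefinite invariant subspace takes up the positive index
of inertia of the generalized eigenspace. -/
theorem finrank_inf_eq_sSup (hG : IsHerm G)
    (hnd : ∀ x, (∀ y, G x y = 0) → x = 0) (hA : ∀ u v, G (A u) (A v) = G u v)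
    {W : Submodule ℂ V} (hW : ∀ w ∈ W, A w ∈ W) (hWp : NonnegOn G W)
    (hWn : NonnegOn (-G) (sesqPerp G W)) {z : ℂ} (hz : star z * z = 1) :
    Module.finrank ℂ (W ⊓ A.maxGenEigenspace z : Submodule ℂ V) =
      sSup {d : ℕ | ∃ P : Submodule ℂ V, P ≤ A.maxGenEigenspace z ∧ PosOn G P ∧
        Module.finrank ℂ P = d} := by
  refine finrank_eq_sSup_posOn hG (fun x hx h => pairing_maxGenEigenspace hnd hA hz hx h)
    inf_le_right (fun w hw => hWp w hw.1) ?_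
  rw [(finrank_sesqPerp_inf_maxGenEigenspace hG hnd hA hW hz).1]
  exact fun w hw => hWn w hw.1

/-- The multiplicity of `z` as an eigenvalue of `A` on `W` is the dimension of `W ∩ E_z`. -/
theorem det_restrict_eq_prod (A : Module.End ℂ V) {W : Submodule ℂ V} (hW : ∀ w ∈ W, A w ∈ W) :
    LinearMap.det (A.restrict hW) = ∏ z ∈ A.charpoly.roots.toFinset,
      z ^ Module.finrank ℂ (W ⊓ A.maxGenEigenspace z : Submodule ℂ V) := by
  have hmult : ∀ z, (A.restrict hW).charpoly.rootMultiplicity z =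
      Module.finrank ℂ (W ⊓ A.maxGenEigenspace z : Submodule ℂ V) := fun z => by
    have h := Submodule.inf_genEigenspace A W (k := ⊤) (μ := z) hW
    rw [← LinearMap.finrank_maxGenEigenspace_eq]
    change Module.finrank ℂ (Module.End.genEigenspace (A.restrict hW) z ⊤) =
      Module.finrank ℂ (W ⊓ A.genEigenspace z ⊤ : Submodule ℂ V)
    rw [h, Submodule.finrank_map_subtype_eq]
  rw [Module.End.det_eq_prod_roots_charpoly_of_splits (IsAlgClosed.splits _),
    Finset.prod_multiset_count]
  have hsub : (A.restrict hW).charpoly.roots.toFinset ⊆ A.charpoly.roots.toFinset := by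
    intro z hz
    rw [Multiset.mem_toFinset, ← Multiset.count_pos, Polynomial.count_roots] at hz ⊢
    rw [hmult] at hz
    rw [← LinearMap.finrank_maxGenEigenspace_eq]
    exact hz.trans_le (Submodule.finrank_mono inf_le_right)
  rw [Finset.prod_subset hsub fun z _ hz => by
    rw [Multiset.mem_toFinset] at hz; rw [Multiset.count_eq_zero_of_notMem hz, pow_zero]]
  refine Finset.prod_congr rfl fun z _ => ?_
  rw [Polynomial.count_roots, hmult]

end Isometry

/-! ### The spectral product of a maximal semidefinite invariant subspace -/

/-- Bookkeeping of eigenvalues: `a z` is the dimension of the generalized eigenspace of a real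
symplectic matrix and `w z` that of its intersection with a maximal semidefinite invariant
subspace. Reflection in the unit circle pairs the factors off the circle into phases `(z / |z|)^{a z}`
with `|z| > 1`, and complex conjugation then cancels all of these except for negative real `z`. -/
theorem prod_phase_eq (S : Finset ℂ) (a w : ℂ → ℕ) (hS : ∀ z, z ∈ S ↔ a z ≠ 0) (h0 : a 0 = 0)
    (hstar : ∀ z, a (star z) = a z)
    (hw : ∀ z, z ≠ 0 → ‖z‖ ≠ 1 → w z + w (star z)⁻¹ = a z)
    (hneg : 2 * w (-1) = a (-1)) :
    ∏ z ∈ S, (z / ‖z‖) ^ w z =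
      (-1) ^ ((∑ z ∈ S.filter (fun z : ℂ => z.im = 0 ∧ z.re < 0), a z) / 2) *
        ∏ z ∈ S.filter (fun z => ‖z‖ = 1 ∧ z ≠ 1 ∧ z ≠ -1), z ^ w z := by
  have hne : ∀ {z}, z ∈ S → z ≠ 0 := fun hz h => (hS _).1 hz (h ▸ h0)
  have hainv : ∀ z, z ≠ 0 → ‖z‖ ≠ 1 → a (star z)⁻¹ = a z := fun z hz hz1 => by
    have h1 := hw z hz hz1
    have h2 := hw (star z)⁻¹ (by simpa using hz) (by simpa using hz1)
    simp only [star_inv₀, star_star, inv_inv] at h2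
    omega
  have hSinv : ∀ z ∈ S, ‖z‖ ≠ 1 → (star z)⁻¹ ∈ S := fun z hz hz1 => by
    rw [hS, hainv z (hne hz) hz1]; exact (hS z).1 hz
  have hinvnorm : ∀ z : ℂ, ‖(star z)⁻¹‖ = ‖z‖⁻¹ := fun z => by simp
  have hphase : ∀ z : ℂ, (star z)⁻¹ / (‖(star z)⁻¹‖ : ℂ) = z / ‖z‖ := fun z => by
    by_cases hz : z = 0
    · simp [hz]
    have hn : (‖z‖ : ℂ) ≠ 0 := by simpa using hz
    have hs : star z ≠ 0 := by simpa using hz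
    rw [hinvnorm]
    push_cast
    field_simp
    have := Complex.mul_conj' z
    rw [sq] at this ⊢
    rw [← this]; exact mul_comm _ _
  -- eigenvalues on the unit circle
  have hcirc : ∏ z ∈ S with ‖z‖ = 1, (z / ‖z‖) ^ w z = (-1) ^ w (-1) *
      ∏ z ∈ S.filter (fun z => ‖z‖ = 1 ∧ z ≠ 1 ∧ z ≠ -1), z ^ w z := by
    rw [← Finset.prod_filter_not_mul_prod_filter _ (fun z : ℂ => z ≠ 1 ∧ z ≠ -1),
      Finset.filter_filter, Finset.filter_filter]
    congr 1
    · have h1 : ∀ z ∈ S.filter (fun z => ‖z‖ = 1 ∧ ¬ (z ≠ 1 ∧ z ≠ -1)),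
          (z / ‖z‖) ^ w z = if z = -1 then (-1) ^ w (-1) else 1 := fun z hz => by
        obtain ⟨-, h1, h2⟩ := Finset.mem_filter.1 hz
        by_cases hz' : z = -1
        · rw [if_pos hz', hz']; simp
        · have : z = 1 := by tauto
          rw [if_neg hz', this]; simp
      rw [Finset.prod_congr rfl h1, Finset.prod_ite_eq']
      split_ifs with hm
      · rfl
      · have : a (-1) = 0 := by
          by_contra hc
          exact hm (Finset.mem_filter.2 ⟨(hS _).2 hc, by simp, by simp⟩)
        have : w (-1) = 0 := by omega
        simp [this]
    · refine Finset.prod_congr rfl fun z hz => ?_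
      rw [(Finset.mem_filter.1 hz).2.1]; simp
  -- reflection in the unit circle preserves the phase
  have hoff : ∏ z ∈ S with ¬ ‖z‖ = 1, (z / ‖z‖) ^ w z =
      ∏ z ∈ S with 1 < ‖z‖, (z / ‖z‖) ^ a z := by
    rw [← Finset.prod_filter_mul_prod_filter_not _ (fun z : ℂ => 1 < ‖z‖), Finset.filter_filter,
      Finset.filter_filter]
    have e1 : S.filter (fun z => ¬ ‖z‖ = 1 ∧ 1 < ‖z‖) = S.filter (fun z => 1 < ‖z‖) :=
      Finset.filter_congr fun z _ => ⟨fun h => h.2, fun h => ⟨h.ne', h⟩⟩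
    have e2 : ∏ z ∈ S.filter (fun z => ¬ ‖z‖ = 1 ∧ ¬ 1 < ‖z‖), (z / ‖z‖) ^ w z =
        ∏ z ∈ S.filter (fun z => 1 < ‖z‖), (z / ‖z‖) ^ w (star z)⁻¹ := by
      refine Finset.prod_nbij' (fun z => (star z)⁻¹) (fun z => (star z)⁻¹) ?_ ?_ ?_ ?_ ?_
      · intro z hz
        obtain ⟨h1, h2, h3⟩ := Finset.mem_filter.1 hz
        refine Finset.mem_filter.2 ⟨hSinv z h1 h2, ?_⟩
        rw [hinvnorm]
        exact (one_lt_inv₀ (norm_pos_iff.2 (hne h1))).2 (lt_of_le_of_ne (not_lt.1 h3) h2)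
      · intro z hz
        obtain ⟨h1, h2⟩ := Finset.mem_filter.1 hz
        refine Finset.mem_filter.2 ⟨hSinv z h1 h2.ne', ?_⟩
        rw [hinvnorm]
        have := inv_lt_one_of_one_lt₀ h2
        exact ⟨this.ne, not_lt.2 this.le⟩
      · intro z _; simp
      · intro z _; simp
      · intro z _
        rw [hphase]; simp
    rw [e1, e2, ← Finset.prod_mul_distrib]
    refine Finset.prod_congr rfl fun z hz => ?_
    obtain ⟨h1, h2⟩ := Finset.mem_filter.1 hz
    rw [← pow_add, hw z (hne h1) h2.ne']
  -- complex conjugate eigenvalues cancel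
  have hreal : ∏ z ∈ S with 1 < ‖z‖, (z / ‖z‖) ^ a z =
      (-1) ^ ∑ z ∈ S.filter (fun z => 1 < ‖z‖ ∧ z.im = 0 ∧ z.re < 0), a z := by
    rw [← Finset.prod_filter_mul_prod_filter_not _ (fun z : ℂ => z.im = 0 ∧ z.re < 0),
      Finset.filter_filter, Finset.filter_filter, ← Finset.prod_pow_eq_pow_sum]
    have e : ∏ z ∈ S.filter (fun z => 1 < ‖z‖ ∧ ¬ (z.im = 0 ∧ z.re < 0)), (z / ‖z‖) ^ a z = 1 := by
      refine Finset.prod_involution (fun z _ => star z) ?_ ?_ ?_ ?_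
      · intro z hz
        obtain ⟨h1, h2, -⟩ := Finset.mem_filter.1 hz
        rw [hstar, ← mul_pow]
        have hn : (‖z‖ : ℂ) ≠ 0 := by simpa using hne h1
        have := Complex.mul_conj' z
        have e : z / ‖z‖ * (star z / ‖star z‖) = 1 := by
          rw [norm_star, div_mul_div_comm]
          rw [show z * star z = (‖z‖ : ℂ) ^ 2 from this, ← sq]
          exact div_self (pow_ne_zero 2 hn)
        rw [e, one_pow]
      · intro z hz h1 heq
        obtain ⟨hzS, h2, h3⟩ := Finset.mem_filter.1 hz
        have him : z.im = 0 := Complex.conj_eq_iff_im.1 heq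
        have hz' : z = (z.re : ℂ) := Complex.ext (by simp) (by simpa using him)
        have hre : 0 ≤ z.re := by
          by_contra hc; exact h3 ⟨him, not_le.1 hc⟩
        apply h1
        have hn : (‖z‖ : ℂ) = z := by
          rw [hz', Complex.norm_real, Real.norm_of_nonneg hre]
        rw [hn, div_self (hne hzS), one_pow]
      · intro z hz
        obtain ⟨hzS, h2, h3⟩ := Finset.mem_filter.1 hz
        exact Finset.mem_filter.2 ⟨(hS _).2 (by rw [hstar]; exact (hS z).1 hzS),
          by simpa using h2, by simpa using h3⟩
      · intro z _; simp
    rw [e, mul_one]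
    refine Finset.prod_congr rfl fun z hz => ?_
    obtain ⟨h1, h2, him, hre⟩ := Finset.mem_filter.1 hz
    have hz' : z = (z.re : ℂ) := Complex.ext (by simp) (by simpa using him)
    have hn : (‖z‖ : ℂ) = -z := by
      rw [hz', Complex.norm_real, Real.norm_of_nonpos hre.le]; simp
    rw [hn, div_neg, div_self (hne h1)]
  -- the number of negative real eigenvalues
  have hcount : ∑ z ∈ S.filter (fun z : ℂ => z.im = 0 ∧ z.re < 0), a z =
      2 * (w (-1) + ∑ z ∈ S.filter (fun z => 1 < ‖z‖ ∧ z.im = 0 ∧ z.re < 0), a z) := by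
    rw [← Finset.sum_filter_add_sum_filter_not _ (fun z : ℂ => 1 < ‖z‖), Finset.filter_filter,
      Finset.filter_filter, ← Finset.sum_filter_add_sum_filter_not
        (S.filter (fun z : ℂ => (z.im = 0 ∧ z.re < 0) ∧ ¬ 1 < ‖z‖)) (fun z : ℂ => z = -1),
      Finset.filter_filter, Finset.filter_filter]
    have e1 : S.filter (fun z : ℂ => (z.im = 0 ∧ z.re < 0) ∧ 1 < ‖z‖) =
        S.filter (fun z => 1 < ‖z‖ ∧ z.im = 0 ∧ z.re < 0) :=
      Finset.filter_congr fun z _ => and_comm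
    have e2 : ∑ z ∈ S.filter (fun z : ℂ => ((z.im = 0 ∧ z.re < 0) ∧ ¬ 1 < ‖z‖) ∧ z = -1), a z =
        2 * w (-1) := by
      rw [hneg]
      by_cases hm : (-1 : ℂ) ∈ S
      · have : S.filter (fun z : ℂ => ((z.im = 0 ∧ z.re < 0) ∧ ¬ 1 < ‖z‖) ∧ z = -1) = {-1} := by
          ext z
          simp only [Finset.mem_filter, Finset.mem_singleton]
          constructor
          · exact fun h => h.2.2
          · rintro rfl
            exact ⟨hm, by simp, rfl⟩
        rw [this, Finset.sum_singleton]
      · have h0 : a (-1) = 0 := by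
          by_contra hc; exact hm ((hS _).2 hc)
        rw [h0]
        refine Finset.sum_eq_zero fun z hz => ?_
        rw [(Finset.mem_filter.1 hz).2.2, h0]
    have e3 : ∑ z ∈ S.filter (fun z : ℂ => ((z.im = 0 ∧ z.re < 0) ∧ ¬ 1 < ‖z‖) ∧ ¬ z = -1), a z =
        ∑ z ∈ S.filter (fun z => 1 < ‖z‖ ∧ z.im = 0 ∧ z.re < 0), a z := by
      have hzre : ∀ z : ℂ, z.im = 0 → z.re < 0 → ‖z‖ = 1 → z = -1 := fun z him hre h => by
        have hz' : z = (z.re : ℂ) := Complex.ext (by simp) (by simpa using him)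
        rw [hz', Complex.norm_real, Real.norm_of_nonpos hre.le] at h
        rw [hz', show z.re = -1 by linarith]; simp
      refine Finset.sum_nbij' (fun z => (star z)⁻¹) (fun z => (star z)⁻¹) ?_ ?_ ?_ ?_ ?_
      · intro z hz
        obtain ⟨h1, ⟨⟨him, hre⟩, h2⟩, h3⟩ := Finset.mem_filter.1 hz
        have hn : ‖z‖ ≠ 1 := fun h => h3 (hzre z him hre h)
        refine Finset.mem_filter.2 ⟨hSinv z h1 hn, ?_, ?_, ?_⟩
        · rw [hinvnorm]
          exact (one_lt_inv₀ (norm_pos_iff.2 (hne h1))).2 (lt_of_le_of_ne (not_lt.1 h2) hn)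
        · simp [him]
        · simp only [Complex.inv_re]
          exact div_neg_of_neg_of_pos (by simpa using hre)
            (Complex.normSq_pos.2 (by simpa using hne h1))
      · intro z hz
        obtain ⟨h1, h2, him, hre⟩ := Finset.mem_filter.1 hz
        have hlt := inv_lt_one_of_one_lt₀ h2
        refine Finset.mem_filter.2 ⟨hSinv z h1 h2.ne', ⟨⟨?_, ?_⟩, ?_⟩, ?_⟩
        · simp [him]
        · simp only [Complex.inv_re]
          exact div_neg_of_neg_of_pos (by simpa using hre)
            (Complex.normSq_pos.2 (by simpa using hne h1))
        · rw [hinvnorm]; exact not_lt.2 hlt.le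
        · intro h
          have := congrArg norm h
          rw [hinvnorm, norm_neg, norm_one] at this
          exact hlt.ne this
      · intro z _; simp
      · intro z _; simp
      · intro z hz
        obtain ⟨h1, ⟨⟨him, hre⟩, h2⟩, h3⟩ := Finset.mem_filter.1 hz
        exact (hainv z (hne h1) fun h => h3 (hzre z him hre h)).symm
    rw [e1, e2, e3]; ring
  rw [← Finset.prod_filter_mul_prod_filter_not S (fun z => ‖z‖ = 1), hcirc, hoff, hreal, hcount,
    Nat.mul_div_cancel_left _ two_pos, pow_add]
  ring

/-! ### The Krein form of the standard symplectic space -/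

section Krein

variable {n : ℕ}

/-- The Hermitian form `i ω₀(ū, v)` on `ℂ²ⁿ`. -/
noncomputable def krein (n : ℕ) :
    (Fin n ⊕ Fin n → ℂ) →ₗ⋆[ℂ] (Fin n ⊕ Fin n → ℂ) →ₗ[ℂ] ℂ :=
  LinearMap.mk₂'ₛₗ (starRingEnd ℂ) (RingHom.id ℂ) (fun u v => Complex.I * omega ℂ n (star u) v)
    (fun u u' v => by simp [star_add, mul_add])
    (fun c u v => by
      rw [star_smul, map_smul, LinearMap.smul_apply, smul_eq_mul, smul_eq_mul,
        show star c = (starRingEnd ℂ) c from rfl]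
      ring)
    (fun u v v' => by simp [mul_add])
    (fun c u v => by simp; ring)

theorem krein_apply (u v : Fin n ⊕ Fin n → ℂ) :
    krein n u v = Complex.I * omega ℂ n (star u) v := rfl

theorem omega_apply {R : Type} [CommRing R] (u v : Fin n ⊕ Fin n → R) :
    omega R n u v = ∑ i, (u (Sum.inl i) * v (Sum.inr i) - u (Sum.inr i) * v (Sum.inl i)) := rfl

theorem omega_swap {R : Type} [CommRing R] (u v : Fin n ⊕ Fin n → R) :
    omega R n u v = -omega R n v u := by
  simp only [omega_apply, ← Finset.sum_neg_distrib]
  exact Finset.sum_congr rfl fun i _ => by ring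

theorem omega_star (u v : Fin n ⊕ Fin n → ℂ) :
    omega ℂ n (star u) (star v) = star (omega ℂ n u v) := by
  simp [omega_apply]

theorem omega_eq_dotProduct {R : Type} [CommRing R] (u v : Fin n ⊕ Fin n → R) :
    omega R n u v = -(u ⬝ᵥ (Matrix.J (Fin n) R).mulVec v) := by
  simp only [omega_apply, Matrix.J, dotProduct, Fintype.sum_sum_type, Matrix.mulVec,
    Matrix.fromBlocks_apply₁₁, Matrix.fromBlocks_apply₁₂, Matrix.fromBlocks_apply₂₁,
    Matrix.fromBlocks_apply₂₂, Matrix.zero_apply, Matrix.neg_apply, zero_mul,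
    Finset.sum_const_zero, zero_add, add_zero, Matrix.one_apply, neg_mul, ite_mul, one_mul,
    Finset.sum_neg_distrib, Finset.sum_ite_eq, Finset.mem_univ, if_true, mul_neg,
    Finset.sum_sub_distrib]
  ring

theorem omega_mulVec {R : Type} [CommRing R] {A : Matrix (Fin n ⊕ Fin n) (Fin n ⊕ Fin n) R}
    (hA : A ∈ Matrix.symplecticGroup (Fin n) R) (u v : Fin n ⊕ Fin n → R) :
    omega R n (A.mulVec u) (A.mulVec v) = omega R n u v := by
  rw [omega_eq_dotProduct, omega_eq_dotProduct, Matrix.mulVec_mulVec, Matrix.dotProduct_mulVec,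
    ← Matrix.vecMul_transpose, Matrix.vecMul_vecMul, ← Matrix.dotProduct_mulVec, ← mul_assoc,
    SymplecticGroup.mem_iff'.1 hA]

theorem omega_nondegenerate {R : Type} [CommRing R] {u : Fin n ⊕ Fin n → R}
    (h : ∀ v, omega R n u v = 0) : u = 0 := by
  ext k
  rcases k with i | i
  · simpa [omega_apply, Pi.single_apply] using h (Pi.single (Sum.inr i) 1)
  · simpa [omega_apply, Pi.single_apply] using h (Pi.single (Sum.inl i) 1)

theorem krein_isHerm : IsHerm (krein n) := fun u v => by
  have := omega_star (star v) u
  rw [star_star] at this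
  rw [krein_apply, krein_apply, star_mul', ← this, omega_swap]
  simp

theorem krein_nondegenerate (u : Fin n ⊕ Fin n → ℂ) (h : ∀ v, krein n u v = 0) : u = 0 := by
  have : star u = 0 := omega_nondegenerate fun v => by
    simpa [krein_apply] using h v
  simpa using this

/-- The complexification of a real matrix. -/
noncomputable abbrev complexify (A : Matrix (Fin n ⊕ Fin n) (Fin n ⊕ Fin n) ℝ) :
    Matrix (Fin n ⊕ Fin n) (Fin n ⊕ Fin n) ℂ := A.map (fun r : ℝ => (r : ℂ))

theorem complexify_mulVec_star (A : Matrix (Fin n ⊕ Fin n) (Fin n ⊕ Fin n) ℝ)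
    (u : Fin n ⊕ Fin n → ℂ) : (complexify A).mulVec (star u) = star ((complexify A).mulVec u) := by
  ext i
  simp [Matrix.mulVec, dotProduct]

theorem complexify_mem {A : Matrix (Fin n ⊕ Fin n) (Fin n ⊕ Fin n) ℝ}
    (hA : A ∈ Matrix.symplecticGroup (Fin n) ℝ) :
    complexify A ∈ Matrix.symplecticGroup (Fin n) ℂ := by
  have := SymplecticGroup.map_mem (f := Complex.ofRealHom) hA
  exact this

theorem krein_isometry {A : Matrix (Fin n ⊕ Fin n) (Fin n ⊕ Fin n) ℝ}
    (hA : A ∈ Matrix.symplecticGroup (Fin n) ℝ) (u v : Fin n ⊕ Fin n → ℂ) :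
    krein n (Matrix.toLin' (complexify A) u) (Matrix.toLin' (complexify A) v) = krein n u v := by
  rw [krein_apply, krein_apply, Matrix.toLin'_apply, Matrix.toLin'_apply,
    ← complexify_mulVec_star, omega_mulVec (complexify_mem hA)]

theorem krein_star (u v : Fin n ⊕ Fin n → ℂ) :
    krein n (star u) (star v) = -star (krein n u v) := by
  rw [krein_apply, krein_apply, omega_star, star_mul']
  simp

/-- The values of the form on vectors `(x, y)` with `y = i c x`. -/
theorem krein_self_re (u : Fin n ⊕ Fin n → ℂ) (c : ℝ)
    (h : ∀ i, u (Sum.inr i) = Complex.I * c * u (Sum.inl i)) :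
    (krein n u u).re = -2 * c * ∑ i, Complex.normSq (u (Sum.inl i)) := by
  rw [krein_apply, omega_apply, Finset.mul_sum, Complex.re_sum, Finset.mul_sum]
  refine Finset.sum_congr rfl fun i _ => ?_
  simp only [Pi.star_apply, h i]
  simp [Complex.normSq_apply]
  ring

/-- The form is definite of the opposite sign on the `n`-dimensional space `{y = i c x}`, which
therefore meets a semidefinite subspace trivially. -/
theorem finrank_le_of_semidefinite {W : Submodule ℂ (Fin n ⊕ Fin n → ℂ)} (c : ℝ) (hc : c ≠ 0)
    (h : ∀ u ∈ W, 0 ≤ c * (krein n u u).re) : Module.finrank ℂ W ≤ n := by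
  let φ : W →ₗ[ℂ] (Fin n → ℂ) :=
    (LinearMap.pi fun i => LinearMap.proj (Sum.inr i) - (Complex.I * (c : ℂ)) •
      LinearMap.proj (Sum.inl i)).comp W.subtype
  have hφ : Function.Injective φ := by
    rw [← LinearMap.ker_eq_bot, LinearMap.ker_eq_bot']
    rintro ⟨u, hu⟩ h0
    have hu' : ∀ i, u (Sum.inr i) = Complex.I * c * u (Sum.inl i) := fun i => by
      have := congrFun h0 i
      simpa [φ, sub_eq_zero] using this
    have h1 := h u hu
    rw [krein_self_re u c hu'] at h1
    have h2 : ∑ i, Complex.normSq (u (Sum.inl i)) = 0 := by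
      refine le_antisymm ?_ (Finset.sum_nonneg fun i _ => Complex.normSq_nonneg _)
      by_contra hpos
      have := mul_pos (mul_pos two_pos (mul_self_pos.2 hc)) (not_le.1 hpos)
      nlinarith
    rw [Finset.sum_eq_zero_iff_of_nonneg fun i _ => Complex.normSq_nonneg _] at h2
    have h3 : ∀ i, u (Sum.inl i) = 0 := fun i => Complex.normSq_eq_zero.1 (h2 i (Finset.mem_univ i))
    ext k
    rcases k with i | i
    · exact h3 i
    · simp [hu' i, h3 i]
  simpa using LinearMap.finrank_le_finrank_of_injective hφ

theorem finrank_le_of_nonnegOn {W : Submodule ℂ (Fin n ⊕ Fin n → ℂ)} (h : NonnegOn (krein n) W) :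
    Module.finrank ℂ W ≤ n :=
  finrank_le_of_semidefinite 1 one_ne_zero fun u hu => by simpa using h u hu

theorem finrank_le_of_nonnegOn_neg {W : Submodule ℂ (Fin n ⊕ Fin n → ℂ)}
    (h : NonnegOn (-krein n) W) : Module.finrank ℂ W ≤ n :=
  finrank_le_of_semidefinite (-1) (by norm_num) fun u hu => by simpa using h u hu

theorem finrank_krein_perp (W : Submodule ℂ (Fin n ⊕ Fin n → ℂ)) :
    Module.finrank ℂ (sesqPerp (krein n) W) + Module.finrank ℂ W = n + n := by
  rw [krein_isHerm.finrank_sesqPerp krein_nondegenerate]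
  simp

theorem finrank_eq_of_maximal {W : Submodule ℂ (Fin n ⊕ Fin n → ℂ)} (h : NonnegOn (krein n) W)
    (h' : NonnegOn (-krein n) (sesqPerp (krein n) W)) : Module.finrank ℂ W = n := by
  have h1 := finrank_le_of_nonnegOn h
  have h2 := finrank_le_of_nonnegOn_neg h'
  have h3 := finrank_krein_perp W
  omega

/-- A positive vector orthogonal to `W` would extend `W` to a semidefinite subspace of dimension
`n + 1`. -/
theorem nonnegOn_neg_perp {W : Submodule ℂ (Fin n ⊕ Fin n → ℂ)} (h : NonnegOn (krein n) W)
    (hd : Module.finrank ℂ W = n) : NonnegOn (-krein n) (sesqPerp (krein n) W) := by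
  intro v hv
  by_contra hcon
  have hpos : 0 < (krein n v v).re := by simpa using hcon
  have h1 : NonnegOn (krein n) (⊥ : Submodule ℂ (Fin n ⊕ Fin n → ℂ)) := fun w hw => by
    simp [(Submodule.mem_bot ℂ).1 hw]
  have h2 : NonnegOn (krein n) (W ⊔ (⊥ ⊔ ℂ ∙ v)) :=
    (h.extend krein_isHerm 0 (R := ⊥) (z := 0) (fun w _ => W.zero_mem)
      (fun w _ => Submodule.zero_mem _) bot_le bot_le hv
      (fun w hw => by simp [(Submodule.mem_bot ℂ).1 hw]) hpos.le (by simp)).1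
  rw [bot_sup_eq] at h2
  have hlt : W < W ⊔ ℂ ∙ v := by
    refine lt_of_le_of_ne le_sup_left fun he => ?_
    have hvW : v ∈ W := he ▸ Submodule.mem_sup_right (Submodule.mem_span_singleton_self v)
    rw [hv v hvW] at hpos
    simp at hpos
  have h3 := Submodule.finrank_lt_finrank_of_lt hlt
  have h4 := finrank_le_of_nonnegOn h2
  omega

/-- The complex conjugate of a complex subspace. -/
def conjSubmodule (U : Submodule ℂ (Fin n ⊕ Fin n → ℂ)) : Submodule ℂ (Fin n ⊕ Fin n → ℂ) where
  carrier := {v | star v ∈ U}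
  zero_mem' := by simp
  add_mem' := fun {a b} ha hb => by
    change star (a + b) ∈ U
    rw [star_add]; exact U.add_mem ha hb
  smul_mem' := fun c a ha => by
    change star (c • a) ∈ U
    rw [star_smul]; exact U.smul_mem _ ha

theorem mem_conjSubmodule {U : Submodule ℂ (Fin n ⊕ Fin n → ℂ)} {v : Fin n ⊕ Fin n → ℂ} :
    v ∈ conjSubmodule U ↔ star v ∈ U := Iff.rfl

theorem finrank_conjSubmodule (U : Submodule ℂ (Fin n ⊕ Fin n → ℂ)) :
    Module.finrank ℂ (conjSubmodule U) = Module.finrank ℂ U := by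
  let j : conjSubmodule U ≃+ U :=
    { toFun := fun v => ⟨star (v : Fin n ⊕ Fin n → ℂ), v.2⟩
      invFun := fun v => ⟨star (v : Fin n ⊕ Fin n → ℂ), by
        rw [mem_conjSubmodule, star_star]; exact v.2⟩
      left_inv := fun v => by simp
      right_inv := fun v => by simp
      map_add' := fun u v => by ext; simp }
  have := rank_eq_of_equiv_equiv (R := ℂ) (R' := ℂ) (star : ℂ → ℂ) j
    star_involutive.bijective (fun r m => by
      apply Subtype.ext
      change star (r • (m : Fin n ⊕ Fin n → ℂ)) = _
      rw [star_smul]; rfl)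
  rw [Module.finrank, Module.finrank, this]

theorem conjSubmodule_maxGenEigenspace (A : Matrix (Fin n ⊕ Fin n) (Fin n ⊕ Fin n) ℝ) (z : ℂ) :
    conjSubmodule (Module.End.maxGenEigenspace (Matrix.toLin' (complexify A)) z) =
      Module.End.maxGenEigenspace (Matrix.toLin' (complexify A)) (star z) := by
  have key : ∀ (z : ℂ) (k : ℕ) (v : Fin n ⊕ Fin n → ℂ),
      ((Matrix.toLin' (complexify A) - (star z) • (1 : Module.End ℂ (Fin n ⊕ Fin n → ℂ))) ^ k)
        (star v) =
      star (((Matrix.toLin' (complexify A) -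
        z • (1 : Module.End ℂ (Fin n ⊕ Fin n → ℂ))) ^ k) v) := by
    intro z k
    induction k with
    | zero => intro v; simp
    | succ k ih =>
      intro v
      rw [pow_succ, pow_succ, Module.End.mul_apply, Module.End.mul_apply, ← ih]
      congr 1
      simp only [LinearMap.sub_apply, LinearMap.smul_apply, Module.End.one_apply, star_sub,
        star_smul, Matrix.toLin'_apply, complexify_mulVec_star]
  ext v
  rw [mem_conjSubmodule, Module.End.mem_maxGenEigenspace, Module.End.mem_maxGenEigenspace]
  refine exists_congr fun k => ?_
  have := key z k (star v)
  rw [star_star] at this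
  rw [this]
  simp

end Krein

/-! ### The Salamon–Zehnder map as the phase of a determinant -/

section Rho

variable {n : ℕ}

/-- The number of negative real eigenvalues, counted over `ℝ` and over `ℂ`. -/
theorem card_negative_roots (A : Matrix (Fin n ⊕ Fin n) (Fin n ⊕ Fin n) ℝ) :
    (A.charpoly.roots.filter (fun r => r < 0)).card =
      ∑ z ∈ (complexify A).charpoly.roots.toFinset.filter (fun z : ℂ => z.im = 0 ∧ z.re < 0),
        (complexify A).charpoly.rootMultiplicity z := by
  have hmap : (complexify A).charpoly = A.charpoly.map Complex.ofRealHom :=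
    Matrix.charpoly_map A Complex.ofRealHom
  have hmult : ∀ r : ℝ, (complexify A).charpoly.rootMultiplicity (r : ℂ) =
      A.charpoly.rootMultiplicity r := fun r => by
    rw [hmap]
    exact (Polynomial.eq_rootMultiplicity_map Complex.ofRealHom.injective r).symm
  rw [← Multiset.toFinset_sum_count_eq]
  refine Finset.sum_bij (fun r _ => (r : ℂ)) ?_ ?_ ?_ ?_
  · intro r hr
    rw [Multiset.mem_toFinset, Multiset.mem_filter, ← Multiset.count_pos,
      Polynomial.count_roots] at hr
    rw [Finset.mem_filter, Multiset.mem_toFinset, ← Multiset.count_pos, Polynomial.count_roots,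
      hmult]
    exact ⟨hr.1, by simp, by simpa using hr.2⟩
  · intro r _ s _ h
    exact Complex.ofReal_injective h
  · intro z hz
    rw [Finset.mem_filter, Multiset.mem_toFinset, ← Multiset.count_pos,
      Polynomial.count_roots] at hz
    have hz' : (z.re : ℂ) = z := Complex.ext (by simp) (by simpa using hz.2.1.symm)
    refine ⟨z.re, ?_, hz'⟩
    rw [Multiset.mem_toFinset, Multiset.mem_filter, ← Multiset.count_pos,
      Polynomial.count_roots, ← hmult, hz']
    exact ⟨hz.1, hz.2.2⟩
  · intro r hr
    rw [Multiset.mem_toFinset, Multiset.mem_filter] at hr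
    rw [hmult, Multiset.count_filter_of_pos (p := fun r : ℝ => r < 0) hr.2,
      Polynomial.count_roots]

/-- The Salamon–Zehnder map of `A` is the phase of the determinant of `A` on any invariant
subspace that is maximal semidefinite for the Krein form. -/
theorem rho_eq_phase_det {A : Matrix (Fin n ⊕ Fin n) (Fin n ⊕ Fin n) ℝ}
    (hA : A ∈ Matrix.symplecticGroup (Fin n) ℝ) {W : Submodule ℂ (Fin n ⊕ Fin n → ℂ)}
    (hW : ∀ w ∈ W, Matrix.toLin' (complexify A) w ∈ W) (hWp : NonnegOn (krein n) W)
    (hd : Module.finrank ℂ W = n) :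
    rho A = LinearMap.det ((Matrix.toLin' (complexify A)).restrict hW) /
      ‖LinearMap.det ((Matrix.toLin' (complexify A)).restrict hW)‖ := by
  set T : Module.End ℂ (Fin n ⊕ Fin n → ℂ) := Matrix.toLin' (complexify A) with hT
  have hiso : ∀ u v, krein n (T u) (T v) = krein n u v := krein_isometry hA
  have hWn := nonnegOn_neg_perp hWp hd
  set a : ℂ → ℕ := fun z => Module.finrank ℂ (T.maxGenEigenspace z) with ha
  set w : ℂ → ℕ := fun z => Module.finrank ℂ (W ⊓ T.maxGenEigenspace z : Submodule ℂ _) with hw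
  have hchar : T.charpoly = (complexify A).charpoly := by
    rw [hT]; exact Matrix.charpoly_toLin' _
  have hmult : ∀ z, a z = (complexify A).charpoly.rootMultiplicity z := fun z => by
    rw [ha, ← hchar]; exact LinearMap.finrank_maxGenEigenspace_eq T z
  have hS : ∀ z, z ∈ (complexify A).charpoly.roots.toFinset ↔ a z ≠ 0 := fun z => by
    rw [Multiset.mem_toFinset, ← Multiset.count_pos, Polynomial.count_roots, hmult,
      Nat.pos_iff_ne_zero]
  have h0 : a 0 = 0 := by
    have : T.maxGenEigenspace 0 = ⊥ := by
      rw [eq_bot_iff]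
      intro x hx
      refine krein_nondegenerate x fun y => ?_
      have hle : (⊤ : Submodule ℂ _) ≤ LinearMap.ker (krein n x) := by
        rw [← Module.End.iSup_maxGenEigenspace_eq_top T, iSup_le_iff]
        exact fun μ y hy => apply_eq_zero_of_mem_maxGenEigenspace hiso (by simp) hx hy
      exact hle trivial
    change Module.finrank ℂ (T.maxGenEigenspace 0) = 0
    rw [this, finrank_bot]
  have hstar : ∀ z, a (star z) = a z := fun z => by
    rw [ha]
    dsimp only
    rw [hT, ← conjSubmodule_maxGenEigenspace, finrank_conjSubmodule]
  have hnorm : ∀ z : ℂ, star z * z = 1 ↔ ‖z‖ = 1 := fun z => by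
    rw [show star z * z = (‖z‖ : ℂ) ^ 2 from Complex.conj_mul' z]
    norm_cast
    exact pow_eq_one_iff_of_nonneg (norm_nonneg z) two_ne_zero
  have hoff : ∀ z, z ≠ 0 → ‖z‖ ≠ 1 → w z + w (star z)⁻¹ = a z := fun z hz hz1 =>
    finrank_inf_add_finrank_inf krein_isHerm krein_nondegenerate hiso hW hWp hWn
      (by rw [star_inv₀, star_star, inv_mul_cancel₀ hz]) (by rwa [Ne, hnorm])
  have hon : ∀ z, ‖z‖ = 1 → w z = mPlus A z := fun z hz =>
    finrank_inf_eq_sSup krein_isHerm krein_nondegenerate hiso hW hWp hWn ((hnorm z).2 hz)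
  have hneg : 2 * w (-1) = a (-1) := by
    have h1 : star (-1 : ℂ) * (-1) = 1 := by simp
    have hconj : conjSubmodule (T.maxGenEigenspace (-1)) = T.maxGenEigenspace (-1) := by
      have := conjSubmodule_maxGenEigenspace A (-1)
      rwa [star_neg, star_one] at this
    obtain ⟨e1, e2⟩ := finrank_sesqPerp_inf_maxGenEigenspace krein_isHerm krein_nondegenerate
      hiso hW h1
    -- the conjugate of the complement of `W` is again maximal semidefinite in this eigenspace
    have e3 := finrank_eq_sSup_posOn (krein_isHerm (n := n)) (E := T.maxGenEigenspace (-1))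
      (W := conjSubmodule (sesqPerp (krein n) W ⊓ T.maxGenEigenspace (-1)))
      (fun x hx h => pairing_maxGenEigenspace krein_nondegenerate hiso h1 hx h)
      (fun v hv => hconj.le hv.2)
      (fun v hv => by
        have := hWn _ hv.1
        simpa [krein_star] using this)
      (by
        rintro v ⟨hv, hvE⟩
        have hv' : star v ∈ T.maxGenEigenspace (-1) := hconj.ge hvE
        have h2 : star v ∈ W := by
          have h3 : star v ∈ sesqPerp (krein n)
              (sesqPerp (krein n) W ⊓ T.maxGenEigenspace (-1)) ⊓ T.maxGenEigenspace (-1) :=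
            ⟨fun x hx => by
              have := hv (star x) (by rw [mem_conjSubmodule, star_star]; exact hx)
              have h4 := krein_star (star x) v
              rw [star_star, this] at h4
              simpa using h4, hv'⟩
          rw [(finrank_sesqPerp_inf_maxGenEigenspace krein_isHerm krein_nondegenerate
            hiso (sesqPerp_invariant hiso (injective_of_isometry
              krein_nondegenerate hiso) hW) h1).1,
            krein_isHerm.sesqPerp_sesqPerp krein_nondegenerate] at h3
          exact h3.1
        have := hWp _ h2
        simpa [krein_star] using this)
    rw [finrank_conjSubmodule] at e3
    have e4 := finrank_inf_eq_sSup krein_isHerm krein_nondegenerate hiso hW hWp hWn h1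
    simp only [hw, ha]
    omega
  have hprod := prod_phase_eq _ a w hS h0 hstar hoff hneg
  have hdet := det_restrict_eq_prod T hW
  rw [hchar] at hdet
  rw [hdet, norm_prod]
  push_cast
  rw [← Finset.prod_div_distrib]
  have e : ∀ z ∈ (complexify A).charpoly.roots.toFinset, z ^ w z / (‖z ^ w z‖ : ℂ) =
      (z / ‖z‖) ^ w z := fun z _ => by rw [norm_pow, div_pow]; push_cast; rfl
  rw [Finset.prod_congr rfl e, hprod, rho]
  congr 1
  · rw [mZero, card_negative_roots]
    simp only [hmult]
  · refine Finset.prod_congr (by congr!) fun z hz => ?_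
    rw [hon z (Finset.mem_filter.1 hz).2.1]

end Rho

/-! ### Continuity of the Salamon–Zehnder map -/

section Continuity

variable {n : ℕ}

theorem det_ne_zero_of_frame {A : Matrix (Fin n ⊕ Fin n) (Fin n ⊕ Fin n) ℝ}
    (hA : A ∈ Matrix.symplecticGroup (Fin n) ℝ) {Q : Matrix (Fin n ⊕ Fin n) (Fin n) ℂ}
    (hQ : Function.Injective Q.mulVec) {M : Matrix (Fin n) (Fin n) ℂ}
    (h : complexify A * Q = Q * M) : M.det ≠ 0 := by
  intro h0
  obtain ⟨x, hx, hMx⟩ := Matrix.exists_mulVec_eq_zero_iff.2 h0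
  apply hx
  have h1 : Matrix.toLin' (complexify A) (Q.mulVec x) = 0 := by
    rw [Matrix.toLin'_apply, Matrix.mulVec_mulVec, h, ← Matrix.mulVec_mulVec, hMx,
      Matrix.mulVec_zero]
  have h2 : Q.mulVec x = Q.mulVec 0 := by
    rw [Matrix.mulVec_zero]
    exact injective_of_isometry krein_nondegenerate (krein_isometry hA) (h1.trans (map_zero _).symm)
  exact hQ h2

/-- `ρ(A)` in terms of a frame `Q` of an invariant semidefinite subspace of dimension `n`. -/
theorem rho_eq_of_frame {A : Matrix (Fin n ⊕ Fin n) (Fin n ⊕ Fin n) ℝ}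
    (hA : A ∈ Matrix.symplecticGroup (Fin n) ℝ) {Q : Matrix (Fin n ⊕ Fin n) (Fin n) ℂ}
    (hQ : Function.Injective Q.mulVec) (hp : ∀ x, 0 ≤ (krein n (Q.mulVec x) (Q.mulVec x)).re)
    {M : Matrix (Fin n) (Fin n) ℂ} (h : complexify A * Q = Q * M) :
    rho A = M.det / ‖M.det‖ := by
  have hinj : Function.Injective (Matrix.toLin' Q) := hQ
  let e := LinearEquiv.ofInjective (Matrix.toLin' Q) hinj
  have hAQ : ∀ x, Matrix.toLin' (complexify A) (Matrix.toLin' Q x) =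
      Matrix.toLin' Q (Matrix.toLin' M x) := fun x => by
    simp only [Matrix.toLin'_apply, Matrix.mulVec_mulVec, h]
  have hW : ∀ w ∈ LinearMap.range (Matrix.toLin' Q), Matrix.toLin' (complexify A) w ∈
      LinearMap.range (Matrix.toLin' Q) := by
    rintro _ ⟨x, rfl⟩
    exact ⟨_, (hAQ x).symm⟩
  have hd : Module.finrank ℂ (LinearMap.range (Matrix.toLin' Q)) = n := by
    rw [LinearMap.finrank_range_of_inj hinj]; simp
  have hdet : LinearMap.det ((Matrix.toLin' (complexify A)).restrict hW) = M.det := by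
    rw [← LinearMap.det_toLin', ← LinearMap.det_conj (Matrix.toLin' M) e]
    congr 1
    ext1 ⟨w, x, hx⟩
    apply Subtype.ext
    have hx' : e x = ⟨w, x, hx⟩ := Subtype.ext hx
    have he : e.symm ⟨w, x, hx⟩ = x := by rw [← hx', e.symm_apply_apply]
    simp only [LinearMap.restrict_apply, LinearMap.comp_apply, LinearEquiv.coe_coe, he]
    rw [← hx, hAQ]; rfl
  rw [rho_eq_phase_det hA hW (by rintro _ ⟨x, rfl⟩; exact hp x) hd, hdet]

theorem mulVec_injective_of_orthonormal {Q : Matrix (Fin n ⊕ Fin n) (Fin n) ℂ}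
    (hQ : Q.conjTranspose * Q = 1) : Function.Injective Q.mulVec := fun x y h => by
  have := congrArg Q.conjTranspose.mulVec h
  simpa [Matrix.mulVec_mulVec, hQ] using this

/-- Every symplectic matrix has an invariant semidefinite subspace of dimension `n`; with respect to
an orthonormal frame `Q`, the matrix of `A` on it is `Q* A Q`. -/
theorem exists_orthonormal_frame {A : Matrix (Fin n ⊕ Fin n) (Fin n ⊕ Fin n) ℝ}
    (hA : A ∈ Matrix.symplecticGroup (Fin n) ℝ) :
    ∃ Q : Matrix (Fin n ⊕ Fin n) (Fin n) ℂ, Q.conjTranspose * Q = 1 ∧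
      (∀ x, 0 ≤ (krein n (Q.mulVec x) (Q.mulVec x)).re) ∧
      complexify A * Q = Q * (Q.conjTranspose * complexify A * Q) := by
  obtain ⟨W, -, hWA, hWp, hWn⟩ := exists_invariant_maximal_nonneg (krein_isHerm (n := n))
    krein_nondegenerate (krein_isometry hA) (L := ⊥)
    (fun w hw => by simp [(Submodule.mem_bot ℂ).1 hw])
    (fun w hw => by simp [(Submodule.mem_bot ℂ).1 hw])
  have hd := finrank_eq_of_maximal hWp hWn
  let ι := (WithLp.linearEquiv 2 ℂ (Fin n ⊕ Fin n → ℂ))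
  let W' : Submodule ℂ (EuclideanSpace ℂ (Fin n ⊕ Fin n)) := W.comap ι.toLinearMap
  have hd' : Module.finrank ℂ W' = n := by
    have h1 := LinearEquiv.finrank_map_eq ι W'
    have h2 : W'.map ι.toLinearMap = W := Submodule.map_comap_eq_of_surjective ι.surjective W
    rw [← h1, h2, hd]
  let b := (stdOrthonormalBasis ℂ W').reindex (finCongr hd')
  let Q : Matrix (Fin n ⊕ Fin n) (Fin n) ℂ := fun i j => (b j : EuclideanSpace ℂ _) i
  have hQQ : Q.conjTranspose * Q = 1 := by
    ext i j
    have := orthonormal_iff_ite.1 b.orthonormal i j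
    rw [Matrix.one_apply, ← this, Matrix.mul_apply, Submodule.coe_inner, PiLp.inner_apply]
    refine Finset.sum_congr rfl fun k _ => ?_
    rw [RCLike.inner_apply, mul_comm]; rfl
  have hrange : ∀ w, w ∈ W ↔ ∃ x, Q.mulVec x = w := by
    intro w
    constructor
    · intro hw
      let w' : W' := ⟨WithLp.toLp 2 w, hw⟩
      refine ⟨b.toBasis.repr w', ?_⟩
      have h1 := congrArg W'.subtype (b.toBasis.sum_repr w')
      ext k
      have h2 := congrArg (fun v : EuclideanSpace ℂ (Fin n ⊕ Fin n) => v k) h1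
      simp only [map_sum, map_smul, Submodule.subtype_apply] at h2
      rw [WithLp.ofLp_sum, Finset.sum_apply] at h2
      simp only [Matrix.mulVec, dotProduct]
      refine Eq.trans (Finset.sum_congr rfl fun j _ => ?_) h2
      simp [Q, mul_comm]
    · rintro ⟨x, rfl⟩
      have : Q.mulVec x = ∑ j, x j • (ι (b j : EuclideanSpace ℂ _)) := by
        ext k
        simp [Matrix.mulVec, dotProduct, Q, ι, mul_comm]
      rw [this]
      exact W.sum_mem fun j _ => W.smul_mem _ (b j).2
  refine ⟨Q, hQQ, fun x => hWp _ ((hrange _).2 ⟨x, rfl⟩), ?_⟩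
  apply Matrix.ext_of_mulVec_single
  intro j
  obtain ⟨y, hy⟩ := (hrange _).1 (hWA _ ((hrange _).2 ⟨Pi.single j 1, rfl⟩))
  rw [Matrix.toLin'_apply] at hy
  simp only [← Matrix.mulVec_mulVec]
  rw [← hy, Matrix.mulVec_mulVec _ Q.conjTranspose, hQQ, Matrix.one_mulVec]

theorem norm_rho {A : Matrix (Fin n ⊕ Fin n) (Fin n ⊕ Fin n) ℝ}
    (hA : A ∈ Matrix.symplecticGroup (Fin n) ℝ) : ‖rho A‖ = 1 := by
  obtain ⟨Q, hQ, hp, h⟩ := exists_orthonormal_frame hA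
  have hinj := mulVec_injective_of_orthonormal hQ
  have := det_ne_zero_of_frame hA hinj h
  rw [rho_eq_of_frame hA hinj hp h, norm_div, Complex.norm_real, norm_norm,
    div_self (norm_ne_zero_iff.2 this)]

theorem isCompact_orthonormal_frames :
    IsCompact {Q : Matrix (Fin n ⊕ Fin n) (Fin n) ℂ | Q.conjTranspose * Q = 1} := by
  have hcpt : IsCompact (Set.pi univ fun _ : Fin n ⊕ Fin n => Set.pi univ fun _ : Fin n =>
      Metric.closedBall (0 : ℂ) 1) :=
    isCompact_univ_pi fun _ => isCompact_univ_pi fun _ => isCompact_closedBall 0 1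
  refine IsCompact.of_isClosed_subset hcpt ?_ ?_
  · exact isClosed_eq (by fun_prop) continuous_const
  · intro Q hQ i _ j _
    have h1 := congrFun (congrFun (show Q.conjTranspose * Q = 1 from hQ) j) j
    rw [Matrix.mul_apply, Matrix.one_apply_eq] at h1
    have h2 := congrArg Complex.re h1
    rw [Complex.re_sum, Complex.one_re] at h2
    have h3 : ∀ k, (Q.conjTranspose j k * Q k j).re = ‖Q k j‖ ^ 2 := fun k => by
      rw [Matrix.conjTranspose_apply, show star (Q k j) * Q k j = (‖Q k j‖ : ℂ) ^ 2 from
        Complex.conj_mul' _]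
      norm_cast
    simp only [h3] at h2
    have h4 : ‖Q i j‖ ^ 2 ≤ 1 := h2 ▸ Finset.single_le_sum
      (f := fun k => ‖Q k j‖ ^ 2) (fun k _ => sq_nonneg _) (Finset.mem_univ i)
    rw [mem_closedBall_zero_iff]
    exact (sq_le_one_iff₀ (norm_nonneg _)).1 h4

/-- The Salamon–Zehnder map is continuous on the symplectic group. Closed sets pull back to
closed sets, because the invariant frames range over a compact set. -/
theorem continuousOn_rho :
    ContinuousOn (rho (n := n)) (Matrix.symplecticGroup (Fin n) ℝ : Set _) := by
  rw [continuousOn_iff_isClosed]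
  intro T hT
  let O := {Q : Matrix (Fin n ⊕ Fin n) (Fin n) ℂ | Q.conjTranspose * Q = 1}
  have : CompactSpace O := isCompact_iff_compactSpace.1 isCompact_orthonormal_frames
  let d : Matrix (Fin n ⊕ Fin n) (Fin n ⊕ Fin n) ℝ × O → ℂ := fun p =>
    (p.2.1.conjTranspose * complexify p.1 * p.2.1).det
  have hcplx : Continuous fun p : Matrix (Fin n ⊕ Fin n) (Fin n ⊕ Fin n) ℝ × O =>
      complexify p.1 := Continuous.matrix_map continuous_fst Complex.continuous_ofReal
  have hd : Continuous d := by
    refine Continuous.matrix_det ?_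
    fun_prop
  let K : Set (Matrix (Fin n ⊕ Fin n) (Fin n ⊕ Fin n) ℝ × O) :=
    {p | p.1 ∈ Matrix.symplecticGroup (Fin n) ℝ ∧
      (∀ x, 0 ≤ (krein n (p.2.1.mulVec x) (p.2.1.mulVec x)).re) ∧
      complexify p.1 * p.2.1 = p.2.1 *
        (p.2.1.conjTranspose * complexify p.1 * p.2.1)}
  have hK : IsClosed K := by
    have h1 : IsClosed {p : Matrix (Fin n ⊕ Fin n) (Fin n ⊕ Fin n) ℝ × O |
        p.1 ∈ Matrix.symplecticGroup (Fin n) ℝ} := by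
      simp only [SymplecticGroup.mem_iff]
      exact isClosed_eq (by fun_prop) continuous_const
    have h2 : IsClosed {p : Matrix (Fin n ⊕ Fin n) (Fin n ⊕ Fin n) ℝ × O |
        ∀ x, 0 ≤ (krein n (p.2.1.mulVec x) (p.2.1.mulVec x)).re} := by
      rw [Set.ofPred_forall]
      refine isClosed_iInter fun x => isClosed_le continuous_const ?_
      have hk : Continuous fun v : Fin n ⊕ Fin n → ℂ => (krein n v v).re := by
        refine Complex.continuous_re.comp ?_
        simp only [krein_apply, omega_apply, Pi.star_apply]
        fun_prop
      exact hk.comp ((continuous_subtype_val.comp continuous_snd).matrix_mulVec continuous_const)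
    exact h1.inter (h2.inter (isClosed_eq (by fun_prop) (by fun_prop)))
  have hKT : IsClosed (K ∩ {p | d p / ‖d p‖ ∈ T}) := by
    refine ContinuousOn.preimage_isClosed_of_isClosed (f := fun p => d p / (‖d p‖ : ℂ)) ?_ hK hT
    refine ContinuousOn.div hd.continuousOn
      (Complex.continuous_ofReal.comp hd.norm).continuousOn fun p hp => ?_
    have := det_ne_zero_of_frame hp.1 (mulVec_injective_of_orthonormal p.2.2) hp.2.2
    simpa [d] using this
  refine ⟨Prod.fst '' (K ∩ {p | d p / ‖d p‖ ∈ T}), isClosedMap_fst_of_compactSpace _ hKT, ?_⟩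
  ext A
  constructor
  · rintro ⟨hAT, hA⟩
    obtain ⟨Q, hQ, hp, h⟩ := exists_orthonormal_frame hA
    refine ⟨⟨(A, ⟨Q, hQ⟩), ⟨⟨hA, hp, h⟩, ?_⟩, rfl⟩, hA⟩
    rw [mem_preimage, rho_eq_of_frame hA (mulVec_injective_of_orthonormal hQ) hp h] at hAT
    exact hAT
  · rintro ⟨⟨⟨B, Q⟩, ⟨⟨hB, hp, h⟩, hBT⟩, rfl⟩, hA⟩
    refine ⟨?_, hA⟩
    rw [mem_preimage]
    dsimp only
    rw [rho_eq_of_frame hA (mulVec_injective_of_orthonormal Q.2) hp h]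
    exact hBT

end Continuity

/-! ### Symplectic maps preserving a coisotropic subspace -/

section Preserving

/-- Every subspace of `Kᵐ` is the column space of a matrix with a left inverse. -/
theorem exists_frame_matrix {K : Type*} [Field K] {m : Type*} [Fintype m] [DecidableEq m]
    (W : Submodule K (m → K)) {d : ℕ} (hd : Module.finrank K W = d) :
    ∃ (Q : Matrix m (Fin d) K) (F : Matrix (Fin d) m K), F * Q = 1 ∧
      ∀ v, v ∈ W ↔ ∃ x, Q.mulVec x = v := by
  let b := Module.finBasisOfFinrankEq K W hd
  let φ : (Fin d → K) →ₗ[K] (m → K) := W.subtype.comp b.equivFun.symm.toLinearMap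
  have hφ : Function.Injective φ := W.injective_subtype.comp b.equivFun.symm.injective
  obtain ⟨ψ, hψ⟩ := LinearMap.exists_leftInverse_of_injective φ (LinearMap.ker_eq_bot.2 hφ)
  refine ⟨LinearMap.toMatrix' φ, LinearMap.toMatrix' ψ, ?_, fun v => ?_⟩
  · rw [← LinearMap.toMatrix'_comp, hψ, LinearMap.toMatrix'_id]
  · simp only [← Matrix.toLin'_apply, Matrix.toLin'_toMatrix']
    constructor
    · intro hv
      exact ⟨b.equivFun ⟨v, hv⟩, by simp [φ, -Module.Basis.equivFun_apply]⟩
    · rintro ⟨x, rfl⟩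
      exact (b.equivFun.symm x).2

theorem exists_eq_mul_of_range {K : Type*} [Field K] {m : Type*} {k l : ℕ} (P : Matrix m (Fin k) K)
    (X : Matrix m (Fin l) K) (h : ∀ x, ∃ y, P.mulVec y = X.mulVec x) :
    ∃ N : Matrix (Fin k) (Fin l) K, X = P * N := by
  choose f hf using h
  refine ⟨Matrix.of fun i j => f (Pi.single j 1) i, Matrix.ext_of_mulVec_single fun j => ?_⟩
  rw [← hf, ← Matrix.mulVec_mulVec]
  congr 1
  ext i
  simp

variable {n : ℕ}

theorem mem_symplComp {C : Submodule ℝ (Vec n)} {v : Vec n} :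
    v ∈ symplComp C ↔ ∀ w ∈ C, omega ℝ n v w = 0 := Iff.rfl

theorem omega_bilin_nondegenerate : LinearMap.BilinForm.Nondegenerate (omega ℝ n) := by
  refine ⟨fun u h => omega_nondegenerate h, fun u h => omega_nondegenerate fun v => ?_⟩
  rw [omega_swap, h v, neg_zero]

theorem omega_isRefl : LinearMap.IsRefl (omega ℝ n) := fun u v h => by
  rw [omega_swap, h, neg_zero]

theorem symplComp_eq_orthogonal (C : Submodule ℝ (Vec n)) :
    symplComp C = LinearMap.BilinForm.orthogonal (omega ℝ n) C := by
  ext v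
  rw [mem_symplComp, LinearMap.BilinForm.mem_orthogonal_iff]
  exact forall₂_congr fun w _ => ⟨fun h => by
    rw [omega_swap, h, neg_zero], fun h => by rw [omega_swap, h, neg_zero]⟩

theorem symplComp_symplComp (C : Submodule ℝ (Vec n)) : symplComp (symplComp C) = C := by
  rw [symplComp_eq_orthogonal, symplComp_eq_orthogonal]
  exact LinearMap.BilinForm.orthogonal_orthogonal omega_bilin_nondegenerate omega_isRefl C

/-- The complexification of a real subspace. -/
def complexifySub (K : Submodule ℝ (Vec n)) : Submodule ℂ (Fin n ⊕ Fin n → ℂ) where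
  carrier := {v | (fun i => (v i).re) ∈ K ∧ (fun i => (v i).im) ∈ K}
  zero_mem' := ⟨K.zero_mem, K.zero_mem⟩
  add_mem' := fun ha hb => ⟨K.add_mem ha.1 hb.1, K.add_mem ha.2 hb.2⟩
  smul_mem' := fun c a ha => by
    constructor
    · have : (fun i => ((c • a) i).re) = c.re • (fun i => (a i).re) - c.im • fun i => (a i).im := by
        ext i; simp
      change (fun i => ((c • a) i).re) ∈ K
      rw [this]
      exact K.sub_mem (K.smul_mem _ ha.1) (K.smul_mem _ ha.2)
    · have : (fun i => ((c • a) i).im) = c.re • (fun i => (a i).im) + c.im • fun i => (a i).re := by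
        ext i; simp
      change (fun i => ((c • a) i).im) ∈ K
      rw [this]
      exact K.add_mem (K.smul_mem _ ha.2) (K.smul_mem _ ha.1)

theorem mem_complexifySub {K : Submodule ℝ (Vec n)} {v : Fin n ⊕ Fin n → ℂ} :
    v ∈ complexifySub K ↔ (fun i => (v i).re) ∈ K ∧ (fun i => (v i).im) ∈ K := Iff.rfl

theorem re_complexify_mulVec (A : Matrix (Fin n ⊕ Fin n) (Fin n ⊕ Fin n) ℝ)
    (v : Fin n ⊕ Fin n → ℂ) :
    (fun i => ((complexify A).mulVec v i).re) = A.mulVec fun i => (v i).re := by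
  ext i
  simp [Matrix.mulVec, dotProduct]

theorem im_complexify_mulVec (A : Matrix (Fin n ⊕ Fin n) (Fin n ⊕ Fin n) ℝ)
    (v : Fin n ⊕ Fin n → ℂ) :
    (fun i => ((complexify A).mulVec v i).im) = A.mulVec fun i => (v i).im := by
  ext i
  simp [Matrix.mulVec, dotProduct]

theorem omega_complex_re_im (u v : Fin n ⊕ Fin n → ℂ) :
    (omega ℂ n u v).re = omega ℝ n (fun i => (u i).re) (fun i => (v i).re) -
        omega ℝ n (fun i => (u i).im) (fun i => (v i).im) ∧
      (omega ℂ n u v).im = omega ℝ n (fun i => (u i).re) (fun i => (v i).im) +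
        omega ℝ n (fun i => (u i).im) (fun i => (v i).re) := by
  simp only [omega_apply, Complex.re_sum, Complex.im_sum, ← Finset.sum_sub_distrib,
    ← Finset.sum_add_distrib]
  constructor <;> refine Finset.sum_congr rfl fun i _ => ?_ <;> simp <;> ring

/-- The complexifications of `C^ω` and `C` are orthogonal for the Krein form. -/
theorem krein_eq_zero_of_mem_symplComp {C : Submodule ℝ (Vec n)} {u v : Fin n ⊕ Fin n → ℂ}
    (hu : u ∈ complexifySub (symplComp C)) (hv : v ∈ complexifySub C) : krein n u v = 0 := by
  have hu1 := hu.1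
  have hu2 := (symplComp C).neg_mem hu.2
  have h := omega_complex_re_im (star u) v
  have e1 : (fun i => ((star u) i).re) = fun i => (u i).re := by ext; simp
  have e2 : (fun i => ((star u) i).im) = -fun i => (u i).im := by ext; simp
  rw [e1, e2] at h
  rw [hu1 _ hv.1, hu2 _ hv.2, hu1 _ hv.2, hu2 _ hv.1] at h
  have : omega ℂ n (star u) v = 0 := Complex.ext (by simpa using h.1) (by simpa using h.2)
  rw [krein_apply, this, mul_zero]

/-- The Krein complement of the complexification of `C^ω` lies in that of `C`. -/
theorem mem_complexifySub_of_perp {C : Submodule ℝ (Vec n)} {v : Fin n ⊕ Fin n → ℂ}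
    (h : ∀ u ∈ complexifySub (symplComp C), krein n u v = 0) : v ∈ complexifySub C := by
  have key : ∀ l ∈ symplComp C, omega ℝ n l (fun i => (v i).re) = 0 ∧
      omega ℝ n l (fun i => (v i).im) = 0 := fun l hl => by
    have h1 := h (fun i => (l i : ℂ)) (by
      rw [mem_complexifySub]
      exact ⟨by simpa using hl, (symplComp C).zero_mem⟩)
    rw [krein_apply, mul_eq_zero, or_iff_right Complex.I_ne_zero] at h1
    have h2 := omega_complex_re_im (star fun i => (l i : ℂ)) v
    have e1 : (fun i => ((star fun i => (l i : ℂ)) i).re) = l := by ext; simp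
    have e2 : (fun i => ((star fun i => (l i : ℂ)) i).im) = 0 := by ext; simp
    rw [e1, e2, h1] at h2
    simp only [map_zero, LinearMap.zero_apply] at h2
    exact ⟨by simpa using h2.1.symm, by simpa using h2.2.symm⟩
  rw [mem_complexifySub]
  nth_rewrite 1 [← symplComp_symplComp C]
  nth_rewrite 2 [← symplComp_symplComp C]
  exact ⟨fun l hl => by rw [omega_swap, (key l hl).1, neg_zero],
    fun l hl => by rw [omega_swap, (key l hl).2, neg_zero]⟩

theorem mulVec_mem_symplComp {A : Matrix (Fin n ⊕ Fin n) (Fin n ⊕ Fin n) ℝ}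
    (hA : A ∈ Matrix.symplecticGroup (Fin n) ℝ) {C D : Submodule ℝ (Vec n)}
    (h : C.map (Matrix.toLin' A) = D) {v : Vec n} (hv : v ∈ symplComp C) :
    A.mulVec v ∈ symplComp D := by
  subst h
  rintro _ ⟨u, hu, rfl⟩
  rw [Matrix.toLin'_apply, omega_mulVec hA, hv u hu]

/-- Let `A` preserve a coisotropic subspace `C`, and let `Θ_t` be symplectic maps which preserve
`C` and induce the identity of `C / C^ω`. On a maximal semidefinite `A`-invariant subspace
between the complexifications of `C^ω` and `C`, the determinant of `A Θ_t` differs from that of `A`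
by the factor `det (Θ_t | C^ω)`, a nonvanishing real function of `t`. Hence `ρ(A Θ_t)` is
constant. -/
theorem rho_mul_eq {C : Submodule ℝ (Vec n)} (hC : IsCoisotropic C)
    {A : Matrix (Fin n ⊕ Fin n) (Fin n ⊕ Fin n) ℝ} (hA : A ∈ Matrix.symplecticGroup (Fin n) ℝ)
    (hAC : C.map (Matrix.toLin' A) = C)
    {Θ : ℝ → Matrix (Fin n ⊕ Fin n) (Fin n ⊕ Fin n) ℝ} (hΘ : ContinuousOn Θ (Icc 0 1))
    (hΘS : ∀ t ∈ Icc (0 : ℝ) 1, Θ t ∈ Matrix.symplecticGroup (Fin n) ℝ) (hΘ0 : Θ 0 = 1)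
    (hΘC : ∀ t ∈ Icc (0 : ℝ) 1, ∀ u ∈ C, (Θ t).mulVec u - u ∈ symplComp C) :
    ∀ t ∈ Icc (0 : ℝ) 1, rho (A * Θ t) = rho A := by
  set L := complexifySub (symplComp C) with hL
  have hLnull : ∀ l ∈ L, ∀ l' ∈ L, krein n l l' = 0 := fun l hl l' hl' =>
    krein_eq_zero_of_mem_symplComp hl ⟨hC hl'.1, hC hl'.2⟩
  obtain ⟨W, hLW, hWA, hWp, hWn⟩ := exists_invariant_maximal_nonneg (krein_isHerm (n := n))
    krein_nondegenerate (krein_isometry hA) (L := L)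
    (fun l hl => by rw [hLnull l hl l hl]; simp)
    (fun l hl => by
      rw [Matrix.toLin'_apply, hL, mem_complexifySub, re_complexify_mulVec, im_complexify_mulVec]
      exact ⟨mulVec_mem_symplComp hA hAC hl.1, mulVec_mem_symplComp hA hAC hl.2⟩)
  have hWC : W ≤ complexifySub C := fun w hw => mem_complexifySub_of_perp fun l hl =>
    krein_isHerm.eq_zero_of_nonnegOn hWp (hLW hl) hw (by rw [hLnull l hl l hl]; simp)
  obtain ⟨Q, F, hFQ, hQ⟩ := exists_frame_matrix W (finrank_eq_of_maximal hWp hWn)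
  obtain ⟨E, F', hFE, hE⟩ := exists_frame_matrix (symplComp C) rfl
  have hQinj : Function.Injective Q.mulVec := fun x y h => by
    simpa [Matrix.mulVec_mulVec, hFQ] using congrArg F.mulVec h
  set Ec := E.map (fun r : ℝ => (r : ℂ)) with hEc
  set Fc := F'.map (fun r : ℝ => (r : ℂ)) with hFc
  have hFEc : Fc * Ec = 1 := by
    have := congrArg (fun M => M.map Complex.ofRealHom) hFE
    simp only [Matrix.map_mul, Matrix.map_one _ (map_zero _) (map_one _)] at this
    exact this
  have hEL : ∀ l ∈ L, ∃ x, Ec.mulVec x = l := fun l hl => by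
    obtain ⟨x, hx⟩ := (hE _).1 hl.1
    obtain ⟨y, hy⟩ := (hE _).1 hl.2
    refine ⟨fun i => ⟨x i, y i⟩, ?_⟩
    ext i
    refine Complex.ext ?_ ?_
    · rw [← congrFun hx i]; simp [Ec, Matrix.mulVec, dotProduct]
    · rw [← congrFun hy i]; simp [Ec, Matrix.mulVec, dotProduct]
  have hLE : ∀ x, Ec.mulVec x ∈ L := fun x => by
    rw [hL, mem_complexifySub, hE, hE]
    exact ⟨⟨fun i => (x i).re, by ext; simp [Ec, Matrix.mulVec, dotProduct]⟩,
      ⟨fun i => (x i).im, by ext; simp [Ec, Matrix.mulVec, dotProduct]⟩⟩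
  -- matrices of `A` on `W`, and of the inclusion of `L` into `W`
  obtain ⟨M, hM⟩ := exists_eq_mul_of_range Q (complexify A * Q) fun x => (hQ _).1 (by
    rw [← Matrix.mulVec_mulVec]
    exact hWA _ ((hQ _).2 ⟨x, rfl⟩))
  obtain ⟨S, hS⟩ := exists_eq_mul_of_range Q Ec fun x => (hQ _).1 (hLW (hLE x))
  have hpos : ∀ x, 0 ≤ (krein n (Q.mulVec x) (Q.mulVec x)).re := fun x =>
    hWp _ ((hQ _).2 ⟨x, rfl⟩)
  -- the determinant of `Θ_t` on `C^ω`
  set f : ℝ → ℝ := fun t => (F' * Θ t * E).det with hf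
  have key : ∀ t ∈ Icc (0 : ℝ) 1, complexify (A * Θ t) * Q = Q * (M * (1 + S * (Fc *
      (complexify (Θ t) - 1) * Q))) ∧ (1 + S * (Fc * (complexify (Θ t) - 1) * Q)).det = (f t : ℂ) := by
    intro t ht
    obtain ⟨N, hN⟩ := exists_eq_mul_of_range Ec ((complexify (Θ t) - 1) * Q) fun x => hEL _ (by
      have hx : Q.mulVec x ∈ complexifySub C := hWC ((hQ _).2 ⟨x, rfl⟩)
      rw [← Matrix.mulVec_mulVec, Matrix.sub_mulVec, Matrix.one_mulVec, hL, mem_complexifySub]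
      constructor
      · have h1 := hΘC t ht _ hx.1
        rw [← re_complexify_mulVec] at h1
        exact h1
      · have h1 := hΘC t ht _ hx.2
        rw [← im_complexify_mulVec] at h1
        exact h1)
    have hN' : Fc * (complexify (Θ t) - 1) * Q = N := by
      rw [Matrix.mul_assoc, hN, ← Matrix.mul_assoc, hFEc, Matrix.one_mul]
    have hΘQ : complexify (Θ t) * Q = Q * (1 + S * N) := by
      rw [Matrix.mul_add, Matrix.mul_one, ← Matrix.mul_assoc, ← hS, ← hN, Matrix.sub_mul,
        Matrix.one_mul]; abel
    rw [hN']
    constructor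
    · have : complexify (A * Θ t) = complexify A * complexify (Θ t) := by
        exact Matrix.map_mul (f := Complex.ofRealHom)
      rw [this, Matrix.mul_assoc, hΘQ, ← Matrix.mul_assoc, hM, Matrix.mul_assoc]
    · rw [Matrix.det_one_add_mul_comm]
      -- `N S` is the matrix of `Θ_t - 1` on `C^ω`, a real matrix
      have h1 : (1 + N * S) = (F' * Θ t * E).map (fun r : ℝ => (r : ℂ)) := by
        have h2 : Ec * (N * S) = (complexify (Θ t) - 1) * Ec := by
          rw [← Matrix.mul_assoc, ← hN, Matrix.mul_assoc, ← hS]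
        have h3 : N * S = Fc * ((complexify (Θ t) - 1) * Ec) := by
          rw [← h2, ← Matrix.mul_assoc, hFEc, Matrix.one_mul]
        have h4 : (F' * Θ t * E).map (fun r : ℝ => (r : ℂ)) = Fc * complexify (Θ t) * Ec := by
          change (F' * Θ t * E).map Complex.ofRealHom = _
          rw [Matrix.map_mul, Matrix.map_mul]; rfl
        rw [h3, h4, Matrix.sub_mul, Matrix.one_mul, Matrix.mul_sub, hFEc, Matrix.mul_assoc]; abel
      rw [h1]
      exact (RingHom.map_det Complex.ofRealHom (F' * Θ t * E)).symm
  have hf0 : f 0 = 1 := by simp [f, hΘ0, hFE]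
  have hfne : ∀ t ∈ Icc (0 : ℝ) 1, f t ≠ 0 := fun t ht h0 => by
    have := det_ne_zero_of_frame (mul_mem hA (hΘS t ht)) hQinj (key t ht).1
    rw [Matrix.det_mul, (key t ht).2, h0] at this
    simp at this
  have hfcont : ContinuousOn f (Icc 0 1) := by
    have h1 : Continuous fun X : Matrix (Fin n ⊕ Fin n) (Fin n ⊕ Fin n) ℝ => (F' * X * E).det :=
      Continuous.matrix_det (by fun_prop)
    exact h1.comp_continuousOn hΘ
  have hfpos : ∀ t ∈ Icc (0 : ℝ) 1, 0 < f t := fun t ht => by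
    by_contra hneg
    have hsub : Icc 0 t ⊆ Icc (0 : ℝ) 1 := Icc_subset_Icc_right ht.2
    obtain ⟨s, hs, hs0⟩ := intermediate_value_Icc' ht.1 (hfcont.mono hsub)
      ⟨not_lt.1 hneg, by rw [hf0]; exact zero_le_one⟩
    exact hfne s (hsub hs) hs0
  intro t ht
  rw [rho_eq_of_frame (mul_mem hA (hΘS t ht)) hQinj hpos (key t ht).1,
    rho_eq_of_frame hA hQinj hpos hM, Matrix.det_mul, (key t ht).2, norm_mul, Complex.norm_real,
    Real.norm_of_nonneg (hfpos t ht).le]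
  push_cast
  exact mul_div_mul_right _ _ (by exact_mod_cast (hfpos t ht).ne')

end Preserving

/-! ### Angle functions and the mean index -/

section MeanIndex

/-- A circle-valued function on the plane has an angle function, the plane being simply connected. -/
theorem exists_angle_plane {f : ℝ × ℝ → ℂ} (hf : Continuous f) (h1 : ∀ p, ‖f p‖ = 1) :
    ∃ α : ℝ × ℝ → ℝ, Continuous α ∧ ∀ p, f p = Complex.exp (Real.pi * Complex.I * α p) := by
  let g : C(ℝ × ℝ, Circle) :=
    ⟨fun p => ⟨f p, mem_sphere_zero_iff_norm.2 (h1 p)⟩, hf.subtype_mk _⟩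
  obtain ⟨F, ⟨-, hF⟩, -⟩ := Circle.isCoveringMap_exp.existsUnique_continuousMap_lifts g (0, 0)
    (Complex.arg (g (0, 0))) (Circle.exp_arg _)
  refine ⟨fun p => F p / Real.pi, F.continuous.div_const _, fun p => ?_⟩
  have h := congrArg (fun z : Circle => (z : ℂ)) (congrFun hF p)
  simp only [Function.comp_apply, Circle.coe_exp] at h
  have hpi : (Real.pi : ℂ) ≠ 0 := by exact_mod_cast Real.pi_ne_zero
  have e : (Real.pi : ℂ) * Complex.I * ((F p / Real.pi : ℝ) : ℂ) = F p * Complex.I := by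
    push_cast; field_simp
  rw [e, h]
  rfl

/-- The increment of an angle function is unique. -/
theorem angle_sub_eq {α β : ℝ → ℝ} (hα : ContinuousOn α (Icc 0 1)) (hβ : ContinuousOn β (Icc 0 1))
    (h : ∀ t ∈ Icc (0 : ℝ) 1, Complex.exp (Real.pi * Complex.I * α t) =
      Complex.exp (Real.pi * Complex.I * β t)) : α 1 - α 0 = β 1 - β 0 := by
  have key : ∀ t ∈ Icc (0 : ℝ) 1, Circle.exp (Real.pi * α t) = Circle.exp (Real.pi * β t) :=
    fun t ht => Circle.ext (by
      have := h t ht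
      rw [Circle.coe_exp, Circle.coe_exp]
      push_cast
      convert this using 2 <;> ring)
  have h0 : (0 : ℝ) ∈ Icc (0 : ℝ) 1 := ⟨le_rfl, zero_le_one⟩
  have heq := Circle.isCoveringMap_exp.eqOn_of_comp_eqOn (s := Icc (0 : ℝ) 1)
    (g₁ := fun t => Real.pi * α t - Real.pi * α 0) (g₂ := fun t => Real.pi * β t - Real.pi * β 0)
    isPreconnected_Icc (by fun_prop) (by fun_prop)
    (fun t ht => by simp only [Function.comp_apply, Circle.exp_sub, key t ht, key 0 h0]) h0
    (by simp)
  have h1 := heq (⟨zero_le_one, le_rfl⟩ : (1 : ℝ) ∈ Icc (0 : ℝ) 1)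
  simp only [← mul_sub] at h1
  exact mul_left_cancel₀ Real.pi_ne_zero h1

variable {n : ℕ}

theorem CoisotropicMaslov.HasMeanIndex.unique {Ψ : ℝ → Matrix (Fin n ⊕ Fin n) (Fin n ⊕ Fin n) ℝ} {d d' : ℝ}
    (h : HasMeanIndex Ψ d) (h' : HasMeanIndex Ψ d') : d = d' := by
  obtain ⟨α, hα, hαΨ, rfl⟩ := h
  obtain ⟨β, hβ, hβΨ, rfl⟩ := h'
  exact angle_sub_eq hα hβ fun t ht => (hαΨ t ht).symm.trans (hβΨ t ht)

/-- The inverse of a symplectic matrix is `-J Aᵀ J`, a polynomial and hence continuous expression. -/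
theorem symplectic_inv {A : Matrix (Fin n ⊕ Fin n) (Fin n ⊕ Fin n) ℝ}
    (hA : A ∈ Matrix.symplecticGroup (Fin n) ℝ) :
    -(Matrix.J (Fin n) ℝ * A.transpose * Matrix.J (Fin n) ℝ) ∈ Matrix.symplecticGroup (Fin n) ℝ ∧
      -(Matrix.J (Fin n) ℝ * A.transpose * Matrix.J (Fin n) ℝ) * A = 1 ∧
      A * -(Matrix.J (Fin n) ℝ * A.transpose * Matrix.J (Fin n) ℝ) = 1 := by
  have h := SymplecticGroup.inv_left_mul_aux hA
  rw [← neg_mul] at h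
  exact ⟨SymplecticGroup.neg_mem (mul_mem (mul_mem (SymplecticGroup.J_mem _ _)
    (SymplecticGroup.transpose_mem hA)) (SymplecticGroup.J_mem _ _)), h, mul_eq_one_comm.1 h⟩

theorem red_mk_eq_iff {C : Submodule ℝ (Vec n)} {u v : C} :
    Red.mk u = Red.mk v ↔ (u : Vec n) - v ∈ symplComp C := by
  rw [Submodule.Quotient.eq]; rfl

variable {C : ℝ → Submodule ℝ (Vec n)} {H : ∀ t : ℝ, Red (C 0) →ₗ[ℝ] Red (C t)}

/-- Two lifts of the same loop have the same mean index: with `Φ = Ψ⁻¹ Ψ'`, an angle function of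
`(s, t) ↦ ρ(Ψ_s Φ_t)` on the square is constant along the side `s = 1`, so that its increments
along the side `t = 0` and along the diagonal agree. -/
theorem CoisotropicMaslov.IsLift.exists_common_meanIndex (hC0 : IsCoisotropic (C 0)) (hC1 : C 1 = C 0)
    {Ψ Ψ' : ℝ → Matrix (Fin n ⊕ Fin n) (Fin n ⊕ Fin n) ℝ} (hΨ : IsLift C H Ψ)
    (hΨ' : IsLift C H Ψ') : ∃ d, HasMeanIndex Ψ d ∧ HasMeanIndex Ψ' d := by
  set J := Matrix.J (Fin n) ℝ with hJ
  set Φ : ℝ → Matrix (Fin n ⊕ Fin n) (Fin n ⊕ Fin n) ℝ := fun t =>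
    -(J * (Ψ t).transpose * J) * Ψ' t with hΦ
  have h0 : (0 : ℝ) ∈ Icc (0 : ℝ) 1 := ⟨le_rfl, zero_le_one⟩
  have h1 : (1 : ℝ) ∈ Icc (0 : ℝ) 1 := ⟨zero_le_one, le_rfl⟩
  have hΦS : ∀ t ∈ Icc (0 : ℝ) 1, Φ t ∈ Matrix.symplecticGroup (Fin n) ℝ := fun t ht =>
    mul_mem (symplectic_inv (hΨ.symplectic t ht)).1 (hΨ'.symplectic t ht)
  have hΨΦ : ∀ t ∈ Icc (0 : ℝ) 1, Ψ t * Φ t = Ψ' t := fun t ht => by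
    rw [hΦ, ← mul_assoc, (symplectic_inv (hΨ.symplectic t ht)).2.2, one_mul]
  have hΦ0 : Φ 0 = 1 := by
    have := hΨΦ 0 h0
    rwa [hΨ.start, hΨ'.start, one_mul] at this
  have hΦc : ContinuousOn Φ (Icc 0 1) := by
    have h1 : Continuous fun X : Matrix (Fin n ⊕ Fin n) (Fin n ⊕ Fin n) ℝ =>
        -(J * X.transpose * J) := by fun_prop
    exact (h1.comp_continuousOn hΨ.continuous).mul hΨ'.continuous
  -- `Φ_t` induces the identity of the reduced space
  have hΦC : ∀ t ∈ Icc (0 : ℝ) 1, ∀ u ∈ C 0, (Φ t).mulVec u - u ∈ symplComp (C 0) := by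
    intro t ht u hu
    have hmem : ∀ {Ψ'' : ℝ → Matrix (Fin n ⊕ Fin n) (Fin n ⊕ Fin n) ℝ}, IsLift C H Ψ'' →
        (Ψ'' t).mulVec u ∈ C t := fun {Ψ''} hL => by
      rw [← hL.map_eq t ht]
      exact ⟨u, hu, Matrix.toLin'_apply _ _⟩
    have e1 := hΨ.induces t ht ⟨u, hu⟩ ⟨_, hmem hΨ⟩ rfl
    have e2 := hΨ'.induces t ht ⟨u, hu⟩ ⟨_, hmem hΨ'⟩ rfl
    have e3 := red_mk_eq_iff.1 (e2.symm.trans e1)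
    dsimp only at e3
    have e4 : (Ψ t).mulVec ((Φ t).mulVec u - u) = (Ψ' t).mulVec u - (Ψ t).mulVec u := by
      rw [Matrix.mulVec_sub, Matrix.mulVec_mulVec, hΨΦ t ht]
    intro w hw
    have e5 := omega_mulVec (hΨ.symplectic t ht) ((Φ t).mulVec u - u) w
    rw [← e5, e4]
    exact e3 _ (by rw [← hΨ.map_eq t ht]; exact ⟨w, hw, Matrix.toLin'_apply _ _⟩)
  have hconst := rho_mul_eq hC0 (hΨ.symplectic 1 h1) ((hΨ.map_eq 1 h1).trans hC1) hΦc hΦS hΦ0 hΦC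
  -- retraction of the line onto `[0,1]`, to extend the function on the square to the plane
  let c : ℝ → ℝ := fun s => max 0 (min 1 s)
  have hc : Continuous c := by fun_prop
  have hcI : ∀ s, c s ∈ Icc (0 : ℝ) 1 := fun s =>
    ⟨le_max_left _ _, max_le zero_le_one (min_le_left _ _)⟩
  have hcs : ∀ s ∈ Icc (0 : ℝ) 1, c s = s := fun s hs => by
    simp only [c]; rw [min_eq_right hs.2, max_eq_right hs.1]
  have hS : ∀ p : ℝ × ℝ, Ψ (c p.1) * Φ (c p.2) ∈ Matrix.symplecticGroup (Fin n) ℝ := fun p =>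
    mul_mem (hΨ.symplectic _ (hcI _)) (hΦS _ (hcI _))
  have hcont : Continuous fun p : ℝ × ℝ => Ψ (c p.1) * Φ (c p.2) :=
    (hΨ.continuous.comp_continuous (hc.comp continuous_fst) fun p => hcI _).mul
      (hΦc.comp_continuous (hc.comp continuous_snd) fun p => hcI _)
  obtain ⟨α, hα, hαρ⟩ := exists_angle_plane (f := fun p : ℝ × ℝ => rho (Ψ (c p.1) * Φ (c p.2)))
    (continuousOn_rho.comp_continuous hcont hS) fun p => norm_rho (hS p)
  have hside : α (1, 1) = α (1, 0) := by
    have h := angle_sub_eq (α := fun t => α (1, t)) (β := fun _ => α (1, 0)) (by fun_prop)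
      (by fun_prop) fun t ht => by
        have e1 := hαρ (1, t)
        have e2 := hαρ (1, 0)
        simp only [hcs _ h1, hcs _ ht, hcs _ h0] at e1 e2
        rw [← e1, ← e2, hconst t ht, hconst 0 h0]
    simp only [sub_self] at h
    exact sub_eq_zero.1 h
  refine ⟨α (1, 0) - α (0, 0), ⟨fun t => α (t, 0), by fun_prop, fun t ht => ?_, rfl⟩,
    ⟨fun t => α (t, t), by fun_prop, fun t ht => ?_, by simp only [hside]⟩⟩
  · rw [← hαρ (t, 0)]
    simp only [hcs _ ht, hcs _ h0, hΦ0, mul_one]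
  · rw [← hαρ (t, t)]
    simp only [hcs _ ht, hΨΦ t ht]

end MeanIndex

/-! ### Continuous frames -/

section Frames

variable {n d : ℕ}

/-- The columns of `E t` form a basis of `C t` for `t ∈ U`, continuous in `t`. -/
def IsMatFrame (C : ℝ → Submodule ℝ (Vec n)) (U : Set ℝ)
    (E : ℝ → Matrix (Fin n ⊕ Fin n) (Fin d) ℝ) : Prop :=
  ContinuousOn E U ∧ ∀ t ∈ U, Function.Injective (E t).mulVec ∧
    ∀ v, v ∈ C t ↔ ∃ x, (E t).mulVec x = v

theorem isFrameOn_iff_isMatFrame {C : ℝ → Submodule ℝ (Vec n)} {U : Set ℝ}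
    {e : Fin d → ℝ → Vec n} :
    IsFrameOn C U e ↔ IsMatFrame C U fun t => Matrix.of fun i j => e j t i := by
  refine and_congr ?_ (forall₂_congr fun t _ => and_congr ?_ ?_)
  · constructor
    · intro h
      refine continuousOn_pi.2 fun i => continuousOn_pi.2 fun j => ?_
      exact continuousOn_pi.1 (h j) i
    · intro h j
      exact continuousOn_pi.2 fun i => continuousOn_pi.1 (continuousOn_pi.1 h i) j
  · exact Matrix.mulVec_injective_iff.symm
  · have : Submodule.span ℝ (range fun i => e i t) =
        LinearMap.range (Matrix.of fun i j => e j t i).mulVecLin := (Matrix.range_mulVecLin _).symm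
    rw [this]
    constructor
    · rintro h v
      rw [← h]; exact LinearMap.mem_range
    · intro h
      ext v
      rw [h v]; exact LinearMap.mem_range

theorem IsMatFrame.mono {C : ℝ → Submodule ℝ (Vec n)} {U U' : Set ℝ}
    {E : ℝ → Matrix (Fin n ⊕ Fin n) (Fin d) ℝ} (h : IsMatFrame C U E) (hU : U' ⊆ U) :
    IsMatFrame C U' E := ⟨h.1.mono hU, fun t ht => h.2 t (hU ht)⟩

theorem IsMatFrame.finrank_eq {C : ℝ → Submodule ℝ (Vec n)} {U : Set ℝ}
    {E : ℝ → Matrix (Fin n ⊕ Fin n) (Fin d) ℝ} (h : IsMatFrame C U E) {t : ℝ} (ht : t ∈ U) :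
    Module.finrank ℝ (C t) = d := by
  have h1 : C t = LinearMap.range (Matrix.toLin' (E t)) := by
    ext v; rw [(h.2 t ht).2 v]; rfl
  rw [h1, LinearMap.finrank_range_of_inj (h.2 t ht).1]
  simp

/-- Two frames of the same subspace differ by an invertible matrix. -/
theorem exists_change_of_frame {K : Type*} [Field K] {m : Type*} {E E' : Matrix m (Fin d) K}
    (hE' : Function.Injective E'.mulVec)
    (h : ∀ v, (∃ x, E.mulVec x = v) ↔ ∃ x, E'.mulVec x = v) :
    ∃ G : Matrix (Fin d) (Fin d) K, E' = E * G ∧ IsUnit G := by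
  obtain ⟨G, hG⟩ := exists_eq_mul_of_range E E' fun x => (h _).2 ⟨x, rfl⟩
  refine ⟨G, hG, Matrix.mulVec_injective_iff_isUnit.1 fun x y hxy => hE' ?_⟩
  rw [hG, ← Matrix.mulVec_mulVec, ← Matrix.mulVec_mulVec, hxy]

theorem IsMatFrame.mul {C : ℝ → Submodule ℝ (Vec n)} {U : Set ℝ}
    {E : ℝ → Matrix (Fin n ⊕ Fin n) (Fin d) ℝ} (h : IsMatFrame C U E)
    {G : Matrix (Fin d) (Fin d) ℝ} (hG : IsUnit G) : IsMatFrame C U fun t => E t * G := by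
  refine ⟨?_, fun t ht => ⟨fun x y hxy => ?_, fun v => ?_⟩⟩
  · have : Continuous fun X : Matrix (Fin n ⊕ Fin n) (Fin d) ℝ => X * G := by fun_prop
    exact this.comp_continuousOn h.1
  · dsimp only at hxy
    rw [← Matrix.mulVec_mulVec, ← Matrix.mulVec_mulVec] at hxy
    exact Matrix.mulVec_injective_iff_isUnit.2 hG ((h.2 t ht).1 hxy)
  · rw [(h.2 t ht).2 v]
    constructor
    · rintro ⟨x, rfl⟩
      refine ⟨G⁻¹.mulVec x, ?_⟩
      rw [Matrix.mulVec_mulVec, Matrix.mul_assoc,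
        Matrix.mul_nonsing_inv G ((Matrix.isUnit_iff_isUnit_det G).1 hG), Matrix.mul_one]
    · rintro ⟨x, rfl⟩
      exact ⟨G.mulVec x, by rw [Matrix.mulVec_mulVec]⟩

/-- Local frames over `[0,1]` can be glued to a global one. -/
theorem exists_global_frame {C : ℝ → Submodule ℝ (Vec n)}
    (h : ∀ t ∈ Icc (0 : ℝ) 1, ∃ U ∈ 𝓝[Icc 0 1] t, ∃ d,
      ∃ E : ℝ → Matrix (Fin n ⊕ Fin n) (Fin d) ℝ, IsMatFrame C U E) :
    ∃ d, ∃ E : ℝ → Matrix (Fin n ⊕ Fin n) (Fin d) ℝ, IsMatFrame C (Icc 0 1) E := by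
  have hopen : ∀ s : unitInterval, ∃ O : Set ℝ, IsOpen O ∧ (s : ℝ) ∈ O ∧ ∃ d,
      ∃ E : ℝ → Matrix (Fin n ⊕ Fin n) (Fin d) ℝ, IsMatFrame C (O ∩ Icc 0 1) E := fun s => by
    obtain ⟨U, hU, d, E, hE⟩ := h s s.2
    obtain ⟨O, hO, hsO, hOU⟩ := mem_nhdsWithin.1 hU
    exact ⟨O, hO, hsO, d, E, hE.mono hOU⟩
  choose O hO hsO hE using hopen
  obtain ⟨t, ht0, htm, ⟨N, hN⟩, ht⟩ := exists_monotone_Icc_subset_open_cover_unitInterval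
    (c := fun s => ((↑) : unitInterval → ℝ) ⁻¹' O s)
    (fun s => (hO s).preimage continuous_subtype_val)
    (fun s _ => mem_iUnion.2 ⟨s, hsO s⟩)
  have key : ∀ k, ∃ d, ∃ E : ℝ → Matrix (Fin n ⊕ Fin n) (Fin d) ℝ,
      IsMatFrame C (Icc 0 (t k : ℝ)) E := by
    intro k
    induction k with
    | zero =>
      obtain ⟨d, E, hE⟩ := hE 0
      refine ⟨d, E, hE.mono ?_⟩
      rw [ht0]
      intro x hx
      have hx0 : x = 0 := le_antisymm hx.2 hx.1
      rw [hx0]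
      exact ⟨hsO 0, le_rfl, zero_le_one⟩
    | succ k ih =>
      obtain ⟨d, E, hEk⟩ := ih
      obtain ⟨s, hs⟩ := ht k
      obtain ⟨d', E', hE'⟩ := hE s
      set a : ℝ := (t k : ℝ) with ha
      have hE'' : IsMatFrame C (Icc a (t (k + 1))) E' := hE'.mono fun x hx => by
        have hx01 : x ∈ Icc (0 : ℝ) 1 := ⟨(t k).2.1.trans hx.1, hx.2.trans (t (k + 1)).2.2⟩
        exact ⟨hs (show (⟨x, hx01⟩ : unitInterval) ∈ Icc (t k) (t (k + 1)) from hx), hx01⟩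
      have hab : a ≤ t (k + 1) := htm (Nat.le_succ k)
      have haL : a ∈ Icc (0 : ℝ) a := ⟨(t k).2.1, le_rfl⟩
      have haR : a ∈ Icc a (t (k + 1) : ℝ) := ⟨le_rfl, hab⟩
      have hdd : d = d' := (hEk.finrank_eq haL).symm.trans (hE''.finrank_eq haR)
      subst hdd
      obtain ⟨G, hG, hGu⟩ := exists_change_of_frame (hEk.2 a haL).1 fun v => by
        rw [← (hE''.2 a haR).2 v, (hEk.2 a haL).2 v]
      have hEG := hE''.mul hGu
      refine ⟨d, fun x => if x ≤ a then E x else E' x * G, ?_, ?_⟩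
      · have hunion : Icc 0 (t (k + 1) : ℝ) = Icc 0 a ∪ Icc a (t (k + 1)) :=
          (Icc_union_Icc_eq_Icc (t k).2.1 hab).symm
        rw [hunion]
        refine ContinuousOn.union_of_isClosed ?_ ?_ isClosed_Icc isClosed_Icc
        · exact hEk.1.congr fun x hx => if_pos hx.2
        · refine hEG.1.congr fun x hx => ?_
          dsimp only
          split_ifs with hxa
          · rw [le_antisymm hxa hx.1]; exact hG
          · rfl
      · intro x hx
        dsimp only
        split_ifs with hxa
        · exact hEk.2 x ⟨hx.1, hxa⟩
        · exact hEG.2 x ⟨(not_le.1 hxa).le, hx.2⟩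
  obtain ⟨d, E, hE⟩ := key N
  rw [hN N le_rfl] at hE
  exact ⟨d, E, hE⟩

theorem CoisotropicMaslov.IsCoisotropicLoop.exists_global_frame {C : ℝ → Submodule ℝ (Vec n)}
    (hC : IsCoisotropicLoop C) :
    ∃ d, ∃ E : ℝ → Matrix (Fin n ⊕ Fin n) (Fin d) ℝ, IsMatFrame C (Icc 0 1) E :=
  _root_.exists_global_frame fun t ht => by
    obtain ⟨U, hU, d, e, he⟩ := hC.continuous t ht
    exact ⟨U, hU, d, _, isFrameOn_iff_isMatFrame.1 he⟩

theorem isUnit_det_gram {m : Type*} [Fintype m] {E : Matrix m (Fin d) ℝ}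
    (hE : Function.Injective E.mulVec) : IsUnit (E.transpose * E).det := by
  rw [isUnit_iff_ne_zero]
  intro h0
  obtain ⟨x, hx, hEx⟩ := Matrix.exists_mulVec_eq_zero_iff.2 h0
  have h1 : E.mulVec x ⬝ᵥ E.mulVec x = 0 := by
    rw [← Matrix.mulVec_mulVec] at hEx
    rw [Matrix.dotProduct_mulVec, ← Matrix.mulVec_transpose, hEx, zero_dotProduct]
  rw [dotProduct_self_eq_zero] at h1
  exact hx (hE (h1.trans (Matrix.mulVec_zero _).symm))

/-- The orthogonal projection onto the column space of `E`. -/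
noncomputable def colProj {m : Type*} [Fintype m] (E : Matrix m (Fin d) ℝ) : Matrix m m ℝ :=
  E * ((E.transpose * E)⁻¹ * E.transpose)

theorem colProj_mulVec {m : Type*} [Fintype m] {E : Matrix m (Fin d) ℝ}
    (hE : Function.Injective E.mulVec) (x : Fin d → ℝ) :
    (colProj E).mulVec (E.mulVec x) = E.mulVec x := by
  rw [colProj, Matrix.mulVec_mulVec, Matrix.mul_assoc, Matrix.mul_assoc,
    Matrix.nonsing_inv_mul _ (isUnit_det_gram hE), Matrix.mul_one]

theorem transpose_mul_colProj {m : Type*} [Fintype m] {E : Matrix m (Fin d) ℝ}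
    (hE : Function.Injective E.mulVec) : E.transpose * colProj E = E.transpose := by
  rw [colProj, ← Matrix.mul_assoc, ← Matrix.mul_assoc,
    Matrix.mul_nonsing_inv _ (isUnit_det_gram hE), Matrix.one_mul]

theorem continuousOn_gram_inv {U : Set ℝ} {m : Type*} [Fintype m] {E : ℝ → Matrix m (Fin d) ℝ}
    (hE : ContinuousOn E U) (hinj : ∀ t ∈ U, Function.Injective (E t).mulVec) :
    ContinuousOn (fun t => ((E t).transpose * E t)⁻¹) U := by
  intro t ht
  have h1 : Continuous fun X : Matrix m (Fin d) ℝ => X.transpose * X := by fun_prop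
  refine ContinuousAt.comp_continuousWithinAt (continuousAt_matrix_inv _ ?_)
    (h1.comp_continuousOn hE t ht)
  rw [Ring.inverse_eq_inv']
  exact continuousAt_inv₀ (isUnit_det_gram (hinj t ht)).ne_zero

theorem continuousOn_colProj {U : Set ℝ} {m : Type*} [Fintype m] {E : ℝ → Matrix m (Fin d) ℝ}
    (hE : ContinuousOn E U) (hinj : ∀ t ∈ U, Function.Injective (E t).mulVec) :
    ContinuousOn (fun t => colProj (E t)) U := by
  have h1 : Continuous fun p : Matrix m (Fin d) ℝ × Matrix (Fin d) (Fin d) ℝ =>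
      p.1 * (p.2 * p.1.transpose) := by fun_prop
  exact h1.comp_continuousOn (hE.prodMk (continuousOn_gram_inv hE hinj))

theorem omega_J_mulVec (u v : Vec n) : omega ℝ n u ((Matrix.J (Fin n) ℝ).mulVec v) = u ⬝ᵥ v := by
  rw [omega_eq_dotProduct, Matrix.mulVec_mulVec, Matrix.J_squared, Matrix.neg_mulVec,
    Matrix.one_mulVec, dotProduct_neg, neg_neg]

theorem finrank_symplComp (C : Submodule ℝ (Vec n)) :
    Module.finrank ℝ (symplComp C) + Module.finrank ℝ C = n + n := by
  have h1 : Module.finrank ℝ (Vec n) = n + n := by simp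
  have h2 : Module.finrank ℝ (symplComp C) = n + n - Module.finrank ℝ C := by
    rw [symplComp_eq_orthogonal]
    exact (LinearMap.BilinForm.finrank_orthogonal omega_bilin_nondegenerate C).trans
      (congrArg (· - _) h1)
  have h3 : Module.finrank ℝ C ≤ n + n := (Submodule.finrank_le C).trans h1.le
  omega

/-- A global frame of `C` gives one of `C^ω`: near `s`, project a basis of `C_s^ω` to `C_t^ω`. -/
theorem IsMatFrame.exists_frame_symplComp {C : ℝ → Submodule ℝ (Vec n)}
    {E : ℝ → Matrix (Fin n ⊕ Fin n) (Fin d) ℝ} (hE : IsMatFrame C (Icc 0 1) E) :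
    ∃ k, ∃ L : ℝ → Matrix (Fin n ⊕ Fin n) (Fin k) ℝ,
      IsMatFrame (fun t => symplComp (C t)) (Icc 0 1) L := by
  apply exists_global_frame
  intro s hs
  set J := Matrix.J (Fin n) ℝ with hJ
  have hJJ : J * J = -1 := Matrix.J_squared _ _
  obtain ⟨k, hk⟩ : ∃ k, Module.finrank ℝ (symplComp (C s)) = k := ⟨_, rfl⟩
  obtain ⟨B, F, hFB, hB⟩ := exists_frame_matrix (symplComp (C s)) hk
  let P : ℝ → Matrix (Fin n ⊕ Fin n) (Fin n ⊕ Fin n) ℝ := fun t => J * (colProj (E t) - 1) * J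
  have hPc : ContinuousOn P (Icc 0 1) := by
    have h1 : Continuous fun X : Matrix (Fin n ⊕ Fin n) (Fin n ⊕ Fin n) ℝ => J * (X - 1) * J := by
      fun_prop
    exact h1.comp_continuousOn (continuousOn_colProj hE.1 fun t ht => (hE.2 t ht).1)
  have hPmem : ∀ t ∈ Icc (0 : ℝ) 1, ∀ v, (P t).mulVec v ∈ symplComp (C t) := fun t ht v w hw => by
    obtain ⟨x, rfl⟩ := ((hE.2 t ht).2 w).1 hw
    simp only [P]
    rw [omega_swap, Matrix.mul_assoc, ← Matrix.mulVec_mulVec, omega_J_mulVec, neg_eq_zero,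
      dotProduct_comm, Matrix.dotProduct_mulVec, ← Matrix.mulVec_transpose, Matrix.mulVec_mulVec,
      ← Matrix.mul_assoc, Matrix.mul_sub, Matrix.mul_one,
      transpose_mul_colProj (hE.2 t ht).1, sub_self, Matrix.zero_mul, Matrix.zero_mulVec,
      zero_dotProduct]
  have hPfix : ∀ v ∈ symplComp (C s), (P s).mulVec v = v := fun v hv => by
    have h1 : (E s).transpose.mulVec (J.mulVec v) = 0 := by
      refine dotProduct_eq_zero_iff.1 fun x => ?_
      rw [Matrix.mulVec_transpose, ← Matrix.dotProduct_mulVec, dotProduct_comm]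
      have h2 := hv _ (((hE.2 s hs).2 _).2 ⟨x, rfl⟩)
      rw [omega_swap, omega_eq_dotProduct] at h2
      simpa using h2
    have h3 : (colProj (E s)).mulVec (J.mulVec v) = 0 := by
      rw [colProj, ← Matrix.mul_assoc, ← Matrix.mulVec_mulVec, h1, Matrix.mulVec_zero]
    simp only [P]
    rw [Matrix.mul_sub, Matrix.sub_mul, Matrix.mul_one, hJJ, Matrix.sub_mulVec, Matrix.mul_assoc,
      ← Matrix.mulVec_mulVec, ← Matrix.mulVec_mulVec, h3, Matrix.mulVec_zero, Matrix.neg_mulVec,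
      Matrix.one_mulVec, zero_sub, neg_neg]
  have hPB : P s * B = B := Matrix.ext_of_mulVec_single fun j => by
    rw [← Matrix.mulVec_mulVec, hPfix _ ((hB _).2 ⟨_, rfl⟩)]
  have hdetc : ContinuousOn (fun t => (F * (P t * B)).det) (Icc 0 1) := by
    have h1 : Continuous fun X : Matrix (Fin n ⊕ Fin n) (Fin n ⊕ Fin n) ℝ =>
        (F * (X * B)).det := Continuous.matrix_det (by fun_prop)
    exact h1.comp_continuousOn hPc
  have hdet0 : (F * (P s * B)).det ≠ 0 := by rw [hPB, hFB]; simp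
  refine ⟨{t | (F * (P t * B)).det ≠ 0} ∩ Icc 0 1,
    Filter.inter_mem ((hdetc s hs).eventually_ne hdet0) self_mem_nhdsWithin, k,
    fun t => P t * B, ?_, ?_⟩
  · have h1 : Continuous fun X : Matrix (Fin n ⊕ Fin n) (Fin n ⊕ Fin n) ℝ => X * B := by fun_prop
    exact (h1.comp_continuousOn hPc).mono inter_subset_right
  · rintro t ⟨ht0, ht⟩
    have hinj : Function.Injective (P t * B).mulVec := fun x y hxy => by
      have h1 := congrArg F.mulVec hxy
      rw [Matrix.mulVec_mulVec, Matrix.mulVec_mulVec] at h1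
      exact Matrix.mulVec_injective_iff_isUnit.2
        ((Matrix.isUnit_iff_isUnit_det _).2 (isUnit_iff_ne_zero.2 ht0)) h1
    refine ⟨hinj, ?_⟩
    have hle : LinearMap.range (Matrix.toLin' (P t * B)) ≤ symplComp (C t) := by
      rintro _ ⟨x, rfl⟩
      rw [Matrix.toLin'_apply, ← Matrix.mulVec_mulVec]
      exact hPmem t ht _
    have heq : LinearMap.range (Matrix.toLin' (P t * B)) = symplComp (C t) := by
      apply Submodule.eq_of_le_of_finrank_eq hle
      rw [LinearMap.finrank_range_of_inj hinj]
      have h1 : Module.finrank ℝ (symplComp (C t)) + d = n + n := by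
        rw [← hE.finrank_eq ht]; exact finrank_symplComp _
      have h2 : k + d = n + n := by
        rw [← hE.finrank_eq hs, ← hk]; exact finrank_symplComp _
      have h3 : Module.finrank ℝ (symplComp (C t)) = k := by omega
      rw [Module.finrank_fintype_fun_eq_card, Fintype.card_fin]
      exact h3.symm
    intro v
    change v ∈ symplComp (C t) ↔ _
    rw [← heq]
    rfl

end Frames

/-! ### Existence of lifts -/

section Lift

variable {n : ℕ}

theorem mem_symplecticGroup_of_omega {A : Matrix (Fin n ⊕ Fin n) (Fin n ⊕ Fin n) ℝ}
    (h : ∀ u v, omega ℝ n (A.mulVec u) (A.mulVec v) = omega ℝ n u v) :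
    A ∈ Matrix.symplecticGroup (Fin n) ℝ := by
  rw [SymplecticGroup.mem_iff']
  refine Matrix.ext_of_mulVec_single fun j => dotProduct_eq _ _ fun u => ?_
  have h1 := h u (Pi.single j 1)
  rw [omega_eq_dotProduct, omega_eq_dotProduct, neg_inj] at h1
  rw [dotProduct_comm, dotProduct_comm _ u, ← h1, ← Matrix.mulVec_mulVec, ← Matrix.mulVec_mulVec,
    Matrix.dotProduct_mulVec, Matrix.vecMul_transpose]

/-- If `p` is a projection with `p = id` on `C^ω`, the map `[u] ↦ u - p u` on `C / C^ω`. -/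
noncomputable def redSection (C : Submodule ℝ (Vec n))
    (p : Matrix (Fin n ⊕ Fin n) (Fin n ⊕ Fin n) ℝ) (hp : ∀ l ∈ symplComp C, p.mulVec l = l) :
    Red C →ₗ[ℝ] Vec n :=
  Submodule.liftQ _ ((LinearMap.id - Matrix.toLin' p).comp C.subtype) (by
    intro l hl
    have hl' : (l : Vec n) ∈ symplComp C := hl
    simp [hp _ hl'])

theorem redSection_mk {C : Submodule ℝ (Vec n)} {p : Matrix (Fin n ⊕ Fin n) (Fin n ⊕ Fin n) ℝ}
    (hp : ∀ l ∈ symplComp C, p.mulVec l = l) (u : C) :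
    redSection C p hp (Red.mk u) = (u : Vec n) - p.mulVec u := by
  rw [redSection, Submodule.liftQ_apply]
  simp

/-- The symplectic form in the decomposition `L ⊕ J L ⊕ (C ∩ L^⊥)`, where `L = C^ω` is the column
space of the given matrix. -/
theorem omega_decomposition {C : Submodule ℝ (Vec n)} (hC : IsCoisotropic C) {k : ℕ}
    {L : Matrix (Fin n ⊕ Fin n) (Fin k) ℝ} (hL : ∀ v, v ∈ symplComp C ↔ ∃ x, L.mulVec x = v)
    {w w' : Vec n} (hw : w ∈ C) (hw' : w' ∈ C) (hp : L.transpose.mulVec w = 0)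
    (hp' : L.transpose.mulVec w' = 0) (a a' c c' : Fin k → ℝ) :
    omega ℝ n (L.mulVec a + (Matrix.J (Fin n) ℝ).mulVec (L.mulVec c) + w)
      (L.mulVec a' + (Matrix.J (Fin n) ℝ).mulVec (L.mulVec c') + w') =
    a ⬝ᵥ (L.transpose * L).mulVec c' - a' ⬝ᵥ (L.transpose * L).mulVec c + omega ℝ n w w' := by
  have hmem : ∀ x, L.mulVec x ∈ symplComp C := fun x => (hL _).2 ⟨x, rfl⟩
  have e1 : omega ℝ n (L.mulVec a) (L.mulVec a') = 0 := hmem a _ (hC (hmem a'))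
  have e2 : omega ℝ n (L.mulVec a) w' = 0 := hmem a _ hw'
  have e3 : omega ℝ n w (L.mulVec a') = 0 := by rw [omega_swap, hmem a' _ hw, neg_zero]
  have hdot : ∀ x y, L.mulVec x ⬝ᵥ L.mulVec y = x ⬝ᵥ (L.transpose * L).mulVec y := fun x y => by
    rw [← Matrix.mulVec_mulVec, Matrix.dotProduct_mulVec x, Matrix.vecMul_transpose]
  have hperp : ∀ {z : Vec n}, L.transpose.mulVec z = 0 → ∀ x, z ⬝ᵥ L.mulVec x = 0 :=
    fun {z} hz x => by
      rw [Matrix.dotProduct_mulVec, ← Matrix.mulVec_transpose, hz, zero_dotProduct]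
  have e4 : omega ℝ n ((Matrix.J (Fin n) ℝ).mulVec (L.mulVec c))
      ((Matrix.J (Fin n) ℝ).mulVec (L.mulVec c')) = 0 := by
    rw [omega_mulVec (SymplecticGroup.J_mem _ _)]
    exact hmem c _ (hC (hmem c'))
  have e5 : omega ℝ n (L.mulVec a) ((Matrix.J (Fin n) ℝ).mulVec (L.mulVec c')) =
      a ⬝ᵥ (L.transpose * L).mulVec c' := by rw [omega_J_mulVec, hdot]
  have e6 : omega ℝ n ((Matrix.J (Fin n) ℝ).mulVec (L.mulVec c)) (L.mulVec a') =
      -(a' ⬝ᵥ (L.transpose * L).mulVec c) := by rw [omega_swap, omega_J_mulVec, hdot]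
  have e7 : omega ℝ n w ((Matrix.J (Fin n) ℝ).mulVec (L.mulVec c')) = 0 := by
    rw [omega_J_mulVec, hperp hp]
  have e8 : omega ℝ n ((Matrix.J (Fin n) ℝ).mulVec (L.mulVec c)) w' = 0 := by
    rw [omega_swap, omega_J_mulVec, hperp hp', neg_zero]
  simp only [map_add, LinearMap.add_apply, e1, e2, e3, e4, e5, e6, e7, e8]
  ring

theorem continuous_mulVec_mulVec {k : ℕ} (A : Matrix (Fin n ⊕ Fin n) (Fin n ⊕ Fin n) ℝ)
    (x : Fin k → ℝ) : Continuous fun q : Matrix (Fin n ⊕ Fin n) (Fin k) ℝ ×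
      Matrix (Fin k) (Fin k) ℝ => A.mulVec (q.1.mulVec (q.2.mulVec x)) :=
  continuous_const.matrix_mulVec (continuous_fst.matrix_mulVec
    (continuous_snd.matrix_mulVec continuous_const))

variable {C : ℝ → Submodule ℝ (Vec n)} {H : ∀ t : ℝ, Red (C 0) →ₗ[ℝ] Red (C t)}

/-- A lift of `(C, H)`. It carries a frame of `L_0 = C_0^ω` to a frame of `L_t`, the dual frame of
`J L_0` to that of `J L_t`, and is given by `H_t` on the complement `C_0 ∩ L_0^⊥ ≅ C_0 / L_0`. -/
theorem exists_isLift (hC : IsCoisotropicLoop C) (hH : IsReducedPath C H) :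
    ∃ Ψ, IsLift C H Ψ := by
  obtain ⟨d, E, hE⟩ := hC.exists_global_frame
  obtain ⟨k, L, hLc, hL⟩ := hE.exists_frame_symplComp
  have h0 : (0 : ℝ) ∈ Icc (0 : ℝ) 1 := ⟨le_rfl, zero_le_one⟩
  set J := Matrix.J (Fin n) ℝ with hJ
  have hJJ : J * J = -1 := Matrix.J_squared _ _
  have hJJv : ∀ v, J.mulVec (J.mulVec v) = -v := fun v => by
    rw [Matrix.mulVec_mulVec, hJJ, Matrix.neg_mulVec, Matrix.one_mulVec]
  set p : ℝ → Matrix (Fin n ⊕ Fin n) (Fin n ⊕ Fin n) ℝ := fun t => colProj (L t) with hp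
  have hpL : ∀ t ∈ Icc (0 : ℝ) 1, ∀ l ∈ symplComp (C t), (p t).mulVec l = l := fun t ht l hl => by
    obtain ⟨x, rfl⟩ := ((hL t ht).2 l).1 hl
    exact colProj_mulVec (hL t ht).1 x
  have hpmem : ∀ t ∈ Icc (0 : ℝ) 1, ∀ v, (p t).mulVec v ∈ symplComp (C t) := fun t ht v =>
    ((hL t ht).2 _).2 ⟨_, by rw [hp]; dsimp only; rw [colProj, ← Matrix.mulVec_mulVec]⟩
  have hpperp : ∀ t ∈ Icc (0 : ℝ) 1, ∀ v,
      (L t).transpose.mulVec ((p t).mulVec v) = (L t).transpose.mulVec v := fun t ht v => by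
    rw [Matrix.mulVec_mulVec, hp, transpose_mul_colProj (hL t ht).1]
  have hpc : ContinuousOn p (Icc 0 1) := continuousOn_colProj hLc fun t ht => (hL t ht).1
  have hperp0 : ∀ t ∈ Icc (0 : ℝ) 1, ∀ u ∈ C t, (L t).transpose.mulVec (J.mulVec u) = 0 :=
    fun t ht u hu => by
      refine dotProduct_eq_zero_iff.1 fun x => ?_
      rw [dotProduct_comm, Matrix.dotProduct_mulVec, Matrix.vecMul_transpose]
      have h2 := ((hL t ht).2 _).2 ⟨x, rfl⟩ u hu
      rw [omega_eq_dotProduct] at h2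
      simpa using h2
  -- the representative of `H_t [u]` in `C_t` that is orthogonal to `L_t`
  let w : ∀ t, C 0 →ₗ[ℝ] Vec n := fun t =>
    if ht : t ∈ Icc (0 : ℝ) 1 then
      (redSection (C t) (p t) (hpL t ht)).comp ((H t).comp (Submodule.mkQ _)) else 0
  have hw : ∀ t (ht : t ∈ Icc (0 : ℝ) 1) (u : C 0) (v : C t), H t (Red.mk u) = Red.mk v →
      w t u = (v : Vec n) - (p t).mulVec v := fun t ht u v hv => by
    have e : w t u = redSection (C t) (p t) (hpL t ht) (H t (Red.mk u)) := by
      simp only [w, dif_pos ht]; rfl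
    rw [e, hv, redSection_mk]
  have hw' : ∀ t ∈ Icc (0 : ℝ) 1, ∀ u : C 0, (L t).transpose.mulVec (w t u) = 0 ∧
      ∃ hm : w t u ∈ C t, H t (Red.mk u) = Red.mk ⟨w t u, hm⟩ := fun t ht u => by
    obtain ⟨v, hv⟩ := Submodule.Quotient.mk_surjective _ (H t (Red.mk u))
    have e := hw t ht u v hv.symm
    refine ⟨by rw [e, Matrix.mulVec_sub, hpperp t ht, sub_self], ?_⟩
    have hm : w t u ∈ C t := by
      rw [e]; exact (C t).sub_mem v.2 (hC.coisotropic t ht (hpmem t ht _))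
    refine ⟨hm, hv.symm.trans (red_mk_eq_iff.2 ?_)⟩
    simp only [e, sub_sub_cancel]
    exact hpmem t ht _
  have hwform : ∀ t ∈ Icc (0 : ℝ) 1, ∀ u u' : C 0, omega ℝ n (w t u) (w t u') =
      omega ℝ n u u' := fun t ht u u' => by
    obtain ⟨-, hm, e⟩ := hw' t ht u
    obtain ⟨-, hm', e'⟩ := hw' t ht u'
    have := hH.symplectic t ht (Red.mk u) (Red.mk u')
    rwa [e, e', redForm_mk, redForm_mk] at this
  have hwzero : ∀ t ∈ Icc (0 : ℝ) 1, ∀ u : C 0, (u : Vec n) ∈ symplComp (C 0) → w t u = 0 :=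
    fun t ht u hu => by
      have h1 : Red.mk u = Red.mk 0 := red_mk_eq_iff.2 (by simpa using hu)
      have h2 : H t (Red.mk u) = Red.mk 0 := by rw [h1]; exact map_zero (H t)
      rw [hw t ht u 0 h2]; simp
  have hwstart : ∀ u : C 0, (L 0).transpose.mulVec u = 0 → w 0 u = u := fun u hu => by
    have h1 : H 0 (Red.mk u) = Red.mk u := by rw [hH.start]; rfl
    rw [hw 0 h0 u u h1, hp]
    dsimp only
    rw [colProj, ← Matrix.mulVec_mulVec, ← Matrix.mulVec_mulVec, hu]
    simp
  have hwc : ∀ u : C 0, ContinuousOn (fun t => w t u) (Icc 0 1) := fun u => by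
    obtain ⟨s, hs, hsH⟩ := hH.continuous (Red.mk u)
    have h1 : Continuous fun q : Vec n × Matrix (Fin n ⊕ Fin n) (Fin n ⊕ Fin n) ℝ =>
        q.1 - q.2.mulVec q.1 :=
      continuous_fst.sub (continuous_snd.matrix_mulVec continuous_fst)
    refine (h1.comp_continuousOn (hs.prodMk hpc)).congr fun t ht => ?_
    obtain ⟨hm, e⟩ := hsH t ht
    exact hw t ht u ⟨s t, hm⟩ e
  -- the component of a vector in `C_0 ∩ L_0^⊥`
  let r' : Vec n →ₗ[ℝ] Vec n := Matrix.toLin' (1 - p 0 + J * p 0 * J)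
  have hr'v : ∀ v, r' v = v - (p 0).mulVec v + J.mulVec ((p 0).mulVec (J.mulVec v)) := fun v => by
    simp [r', Matrix.mul_assoc]
  have hr'C : ∀ v, r' v ∈ C 0 := fun v => by
    rw [← symplComp_symplComp (C 0)]
    intro l hl
    obtain ⟨x, rfl⟩ := ((hL 0 h0).2 l).1 hl
    have h1 : J.mulVec (r' v) = J.mulVec v - J.mulVec ((p 0).mulVec v) -
        (p 0).mulVec (J.mulVec v) := by
      rw [hr'v, Matrix.mulVec_add, Matrix.mulVec_sub, hJJv, sub_eq_add_neg _ ((p 0).mulVec _)]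
    rw [omega_swap, omega_eq_dotProduct, neg_neg, ← hJ, h1, ← Matrix.vecMul_transpose,
      ← Matrix.dotProduct_mulVec, Matrix.mulVec_sub, Matrix.mulVec_sub, hpperp 0 h0,
      hperp0 0 h0 _ (hC.coisotropic 0 h0 (hpmem 0 h0 v))]
    simp
  have hr'p : ∀ v, (L 0).transpose.mulVec (r' v) = 0 := fun v => by
    rw [hr'v, Matrix.mulVec_add, Matrix.mulVec_sub, hpperp 0 h0,
      hperp0 0 h0 _ (hC.coisotropic 0 h0 (hpmem 0 h0 _)), sub_self, add_zero]
  let r : Vec n →ₗ[ℝ] C 0 := LinearMap.codRestrict (C 0) r' hr'C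
  set g : ℝ → Matrix (Fin k) (Fin k) ℝ := fun t => (L t).transpose * L t with hg
  have hgdet : ∀ t ∈ Icc (0 : ℝ) 1, IsUnit (g t).det := fun t ht => isUnit_det_gram (hL t ht).1
  let a : Vec n → Fin k → ℝ := fun v => (g 0)⁻¹.mulVec ((L 0).transpose.mulVec v)
  let b : Vec n → Fin k → ℝ := fun v => -(L 0).transpose.mulVec (J.mulVec v)
  let ψ : ℝ → Vec n →ₗ[ℝ] Vec n := fun t =>
    Matrix.toLin' (L t * ((g 0)⁻¹ * (L 0).transpose)) -
      Matrix.toLin' (J * (L t * ((g t)⁻¹ * ((L 0).transpose * J)))) + (w t).comp r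
  have hψ : ∀ t v, ψ t v = (L t).mulVec (a v) +
      J.mulVec ((L t).mulVec ((g t)⁻¹.mulVec (b v))) + w t (r v) := fun t v => by
    simp [ψ, a, b, Matrix.mulVec_neg, ← sub_eq_add_neg]
  clear_value ψ w
  have hψ0 : ψ 0 = LinearMap.id := by
    refine LinearMap.ext fun v => ?_
    have h1 : (L 0).mulVec (a v) = (p 0).mulVec v := by
      simp only [a, hp, colProj, Matrix.mulVec_mulVec]; rfl
    have h2 : (L 0).mulVec ((g 0)⁻¹.mulVec (b v)) = -(p 0).mulVec (J.mulVec v) := by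
      simp only [b, hp, hg, colProj, Matrix.mulVec_mulVec, Matrix.mulVec_neg, Matrix.mul_assoc]
    have h3 : w 0 (r v) = r' v := hwstart (r v) (hr'p v)
    rw [hψ, h1, h2, h3, hr'v, Matrix.mulVec_neg, LinearMap.id_apply]
    abel
  have hψω : ∀ t ∈ Icc (0 : ℝ) 1, ∀ v v', omega ℝ n (ψ t v) (ψ t v') =
      a v ⬝ᵥ b v' - a v' ⬝ᵥ b v + omega ℝ n (r v : Vec n) (r v' : Vec n) := fun t ht v v' => by
    rw [hψ, hψ, omega_decomposition (hC.coisotropic t ht) (hL t ht).2 (hw' t ht _).2.choose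
      (hw' t ht _).2.choose (hw' t ht _).1 (hw' t ht _).1, hwform t ht, Matrix.mulVec_mulVec,
      Matrix.mulVec_mulVec, Matrix.mul_nonsing_inv (g t) (hgdet t ht), Matrix.one_mulVec,
      Matrix.one_mulVec]
  have hψS : ∀ t ∈ Icc (0 : ℝ) 1, ∀ v v', omega ℝ n (ψ t v) (ψ t v') = omega ℝ n v v' :=
    fun t ht v v' => by
      rw [hψω t ht, ← hψω 0 h0, hψ0]; rfl
  have hψC : ∀ t ∈ Icc (0 : ℝ) 1, ∀ u : C 0, ψ t u = (L t).mulVec (a u) + w t u :=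
    fun t ht u => by
      have h1 : b u = 0 := by
        change -(L 0).transpose.mulVec (J.mulVec u) = 0
        rw [hperp0 0 h0 u u.2, neg_zero]
      have h2 : r u = u - ⟨(p 0).mulVec u, hC.coisotropic 0 h0 (hpmem 0 h0 _)⟩ := by
        apply Subtype.ext
        change r' u = u - (p 0).mulVec u
        have h3 : (p 0).mulVec (J.mulVec u) = 0 := by
          rw [hp]; dsimp only
          rw [colProj, ← Matrix.mulVec_mulVec, ← Matrix.mulVec_mulVec, hperp0 0 h0 u u.2]
          simp
        rw [hr'v, h3, Matrix.mulVec_zero, add_zero]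
      rw [hψ, h1, h2, map_sub, hwzero t ht ⟨(p 0).mulVec u, _⟩ (hpmem 0 h0 _)]
      simp
  have hψmem : ∀ t ∈ Icc (0 : ℝ) 1, ∀ u : C 0, ψ t u ∈ C t := fun t ht u => by
    rw [hψC t ht]
    exact (C t).add_mem (hC.coisotropic t ht (((hL t ht).2 _).2 ⟨_, rfl⟩)) (hw' t ht u).2.choose
  have hΨv : ∀ t v, (LinearMap.toMatrix' (ψ t)).mulVec v = ψ t v := fun t v => by
    rw [← Matrix.toLin'_apply, Matrix.toLin'_toMatrix']
  have hΨS : ∀ t ∈ Icc (0 : ℝ) 1, LinearMap.toMatrix' (ψ t) ∈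
      Matrix.symplecticGroup (Fin n) ℝ := fun t ht =>
    mem_symplecticGroup_of_omega fun u v => by rw [hΨv, hΨv, hψS t ht]
  have hψinj : ∀ t ∈ Icc (0 : ℝ) 1, Function.Injective (ψ t) := fun t ht => by
    rw [← LinearMap.ker_eq_bot, LinearMap.ker_eq_bot']
    intro v hv
    exact omega_nondegenerate fun v' => by rw [← hψS t ht, hv]; simp
  clear_value a b r
  refine ⟨fun t => LinearMap.toMatrix' (ψ t), ?_, hΨS, ?_, ?_, ?_⟩
  · have hψc : ∀ v, ContinuousOn (fun t => ψ t v) (Icc 0 1) := fun v => by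
      simp only [hψ]
      refine ContinuousOn.add (ContinuousOn.add ?_ ?_) (hwc (r v))
      · exact (continuous_id.matrix_mulVec continuous_const).comp_continuousOn hLc
      · have h1 := continuousOn_gram_inv hLc fun t ht => (hL t ht).1
        exact (continuous_mulVec_mulVec J (b v)).comp_continuousOn
          (f := fun t => (L t, (g t)⁻¹)) (hLc.prodMk h1)
    refine continuousOn_pi.2 fun i => continuousOn_pi.2 fun j => ?_
    refine (continuousOn_pi.1 (hψc (Pi.single j 1)) i).congr fun t _ => ?_
    rw [LinearMap.toMatrix'_apply]
  · rw [hψ0, LinearMap.toMatrix'_id]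
  · intro t ht
    rw [Matrix.toLin'_toMatrix']
    apply Submodule.eq_of_le_of_finrank_eq
    · rintro _ ⟨u, hu, rfl⟩
      exact hψmem t ht ⟨u, hu⟩
    · rw [← (Submodule.equivMapOfInjective (ψ t) (hψinj t ht) (C 0)).finrank_eq,
        hE.finrank_eq h0, hE.finrank_eq ht]
  · intro t ht u v huv
    obtain ⟨-, hm, e⟩ := hw' t ht u
    rw [e]
    refine red_mk_eq_iff.2 ?_
    rw [huv, hΨv, hψC t ht]
    simp only [sub_add_cancel_right]
    exact (symplComp (C t)).neg_mem (((hL t ht).2 _).2 ⟨_, rfl⟩)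

end Lift

/-! ### The loop traversed twice -/

section Twice

theorem continuousOn_concat {X : Type*} [TopologicalSpace X] {f g : ℝ → X}
    (hf : ContinuousOn f (Icc 0 1)) (hg : ContinuousOn g (Icc 0 1)) (h : f 1 = g 0) :
    ContinuousOn (fun t : ℝ => if t ≤ 1 / 2 then f (2 * t) else g (2 * t - 1)) (Icc 0 1) := by
  refine ContinuousOn.if (fun t ht => ?_) ?_ ?_
  · have h1 : t = 1 / 2 := by
      have := ht.2
      rwa [show {a : ℝ | a ≤ 1 / 2} = Iic (1 / 2) from rfl, frontier_Iic] at this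
    subst h1
    norm_num [h]
  · rw [show {a : ℝ | a ≤ 1 / 2} = Iic (1 / 2) from rfl, closure_Iic]
    refine hf.comp (by fun_prop) fun t ht => ?_
    have h1 := ht.1.1
    have h2 : t ≤ 1 / 2 := ht.2
    constructor <;> linarith
  · rw [show {a : ℝ | ¬ a ≤ 1 / 2} = Ioi (1 / 2) from by ext; simp, closure_Ioi]
    refine hg.comp (by fun_prop) fun t ht => ?_
    have h1 := ht.1.2
    have h2 : 1 / 2 ≤ t := ht.2
    constructor <;> linarith

variable {n : ℕ} {C : ℝ → Submodule ℝ (Vec n)} {H : ∀ t : ℝ, Red (C 0) →ₗ[ℝ] Red (C t)}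

theorem two_mul_mem_Icc {t : ℝ} (ht : t ∈ Icc (0 : ℝ) 1) (h : t ≤ 1 / 2) :
    2 * t ∈ Icc (0 : ℝ) 1 := by
  have := ht.1
  constructor <;> linarith

theorem two_mul_sub_one_mem_Icc {t : ℝ} (ht : t ∈ Icc (0 : ℝ) 1) (h : ¬ t ≤ 1 / 2) :
    2 * t - 1 ∈ Icc (0 : ℝ) 1 := by
  have := ht.2
  constructor <;> linarith

theorem twice_eq_left (C : ℝ → Submodule ℝ (Vec n)) {t : ℝ} (h : t ≤ 1 / 2) :
    twice C t = C (2 * t) := if_pos h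

theorem twice_eq_right (C : ℝ → Submodule ℝ (Vec n)) {t : ℝ} (h : ¬ t ≤ 1 / 2) :
    twice C t = C (2 * t - 1) := if_neg h

theorem twice_one (C : ℝ → Submodule ℝ (Vec n)) : twice C 1 = C 1 := by
  rw [twice_eq_right C (by norm_num)]
  norm_num

theorem redForm_redCast {C D : Submodule ℝ (Vec n)} (h : C = D) (x y : Red C) :
    redForm D (redCast h x) (redCast h y) = redForm C x y := by
  subst h
  obtain ⟨u, rfl⟩ := Submodule.Quotient.mk_surjective _ x
  obtain ⟨v, rfl⟩ := Submodule.Quotient.mk_surjective _ y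
  rfl

theorem redCast_mk {C D : Submodule ℝ (Vec n)} (h : C = D) (u : C) :
    redCast h (Red.mk u) = Red.mk ⟨u, h ▸ u.2⟩ := rfl

theorem redCast_rfl {C : Submodule ℝ (Vec n)} (h : C = C) (x : Red C) : redCast h x = x := by
  obtain ⟨u, rfl⟩ := Submodule.Quotient.mk_surjective _ x
  rfl

/-- If the global frame `E` of a loop has monodromy `G`, then the loop traversed twice has a global
frame with monodromy `G²`. -/
theorem exists_frame_twice (hC : IsCoisotropicLoop C) :
    ∃ d, ∃ F : ℝ → Matrix (Fin n ⊕ Fin n) (Fin d) ℝ, IsMatFrame (twice C) (Icc 0 1) F ∧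
      ∃ G : Matrix (Fin d) (Fin d) ℝ, 0 < G.det ∧ F 1 = F 0 * G := by
  obtain ⟨d, E, hE⟩ := hC.exists_global_frame
  have h0 : (0 : ℝ) ∈ Icc (0 : ℝ) 1 := ⟨le_rfl, zero_le_one⟩
  have h1 : (1 : ℝ) ∈ Icc (0 : ℝ) 1 := ⟨zero_le_one, le_rfl⟩
  obtain ⟨G, hG, hGu⟩ : ∃ G : Matrix (Fin d) (Fin d) ℝ, E 1 = E 0 * G ∧ IsUnit G :=
    exists_change_of_frame (hE.2 1 h1).1 fun v => by
      rw [← (hE.2 0 h0).2 v, ← (hE.2 1 h1).2 v, hC.closed]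
  have hEG := hE.mul hGu
  refine ⟨d, fun t => if t ≤ 1 / 2 then E (2 * t) else E (2 * t - 1) * G,
    ⟨continuousOn_concat hE.1 hEG.1 hG, fun t ht => ?_⟩, G * G, ?_, ?_⟩
  · by_cases h : t ≤ 1 / 2
    · simp only [if_pos h, twice_eq_left C h]
      exact hE.2 _ (two_mul_mem_Icc ht h)
    · simp only [if_neg h, twice_eq_right C h]
      exact hEG.2 _ (two_mul_sub_one_mem_Icc ht h)
  · rw [Matrix.det_mul]
    exact mul_self_pos.2 ((Matrix.isUnit_iff_isUnit_det G).1 hGu).ne_zero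
  · norm_num [hG, Matrix.mul_assoc]

theorem isOriented_twice (hC : IsCoisotropicLoop C) : IsOriented (twice C) := by
  obtain ⟨d, F, hF, G, hG, hFG⟩ := exists_frame_twice hC
  refine ⟨d, fun j t i => F t i j, isFrameOn_iff_isMatFrame.2 hF, G, hG, fun j => ?_⟩
  ext i
  simp [hFG, Matrix.mul_apply, mul_comm]

theorem isCoisotropicLoop_twice (hC : IsCoisotropicLoop C) : IsCoisotropicLoop (twice C) where
  coisotropic t ht := by
    by_cases h : t ≤ 1 / 2
    · rw [twice_eq_left C h]
      exact hC.coisotropic _ (two_mul_mem_Icc ht h)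
    · rw [twice_eq_right C h]
      exact hC.coisotropic _ (two_mul_sub_one_mem_Icc ht h)
  continuous t _ := by
    obtain ⟨d, F, hF, -⟩ := exists_frame_twice hC
    exact ⟨Icc 0 1, self_mem_nhdsWithin, d, fun j t i => F t i j, isFrameOn_iff_isMatFrame.2 hF⟩
  closed := by rw [twice_one, twice_zero, hC.closed]

theorem isReducedPath_twiceRed (hC : IsCoisotropicLoop C) (hH : IsReducedPath C H) :
    IsReducedPath (twice C) (twiceRed hC.closed H) where
  symplectic t ht x y := by
    have h1 : (1 : ℝ) ∈ Icc (0 : ℝ) 1 := ⟨zero_le_one, le_rfl⟩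
    by_cases h : t ≤ 1 / 2
    · simp only [twiceRed, dif_pos h, LinearMap.comp_apply, redForm_redCast]
      rw [hH.symplectic _ (two_mul_mem_Icc ht h), redForm_redCast]
    · simp only [twiceRed, dif_neg h, LinearMap.comp_apply, redForm_redCast]
      rw [hH.symplectic _ (two_mul_sub_one_mem_Icc ht h), redForm_redCast, hH.symplectic _ h1,
        redForm_redCast]
  continuous x := by
    have h0 : (0 : ℝ) ∈ Icc (0 : ℝ) 1 := ⟨le_rfl, zero_le_one⟩
    have h1 : (1 : ℝ) ∈ Icc (0 : ℝ) 1 := ⟨zero_le_one, le_rfl⟩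
    obtain ⟨d, E, hE⟩ := hC.exists_global_frame
    obtain ⟨k, L, hLc, hL⟩ := hE.exists_frame_symplComp
    obtain ⟨w₁, hw₁, e₁⟩ := hH.continuous (redCast (twice_zero C) x)
    obtain ⟨w₂, hw₂, e₂⟩ :=
      hH.continuous (redCast hC.closed (H 1 (redCast (twice_zero C) x)))
    -- the representatives of the two halves differ at the common point by an element of `C_0^ω`,
    -- which is extended to a section of the `C_t^ω`
    obtain ⟨y, hy⟩ : ∃ y, (L 0).mulVec y = w₁ 1 - w₂ 0 := by
      obtain ⟨m₁, f₁⟩ := e₁ 1 h1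
      obtain ⟨m₂, f₂⟩ := e₂ 0 h0
      rw [hH.start, LinearMap.id_apply, f₁, redCast_mk] at f₂
      exact ((hL 0 h0).2 _).1 (red_mk_eq_iff.1 f₂)
    have hw₃ : ContinuousOn (fun s => w₂ s + (L s).mulVec y) (Icc 0 1) :=
      hw₂.add ((continuous_id.matrix_mulVec continuous_const).comp_continuousOn hLc)
    refine ⟨_, continuousOn_concat hw₁ hw₃ (by simp [hy]), fun t ht => ?_⟩
    by_cases h : t ≤ 1 / 2
    · obtain ⟨m, f⟩ := e₁ _ (two_mul_mem_Icc ht h)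
      simp only [if_pos h, twiceRed, dif_pos h, LinearMap.comp_apply]
      exact ⟨by rwa [twice_eq_left C h], by rw [f]; rfl⟩
    · have hs := two_mul_sub_one_mem_Icc ht h
      obtain ⟨m, f⟩ := e₂ _ hs
      have hl := ((hL _ hs).2 _).2 ⟨y, rfl⟩
      have m' := (C _).add_mem m (hC.coisotropic _ hs hl)
      have f' : Red.mk ⟨_, m⟩ = Red.mk ⟨_, m'⟩ := red_mk_eq_iff.2 (by
        simpa using (symplComp (C (2 * t - 1))).neg_mem hl)
      simp only [if_neg h, twiceRed, dif_neg h, LinearMap.comp_apply]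
      exact ⟨by rwa [twice_eq_right C h], by rw [f, f']; rfl⟩
  start := by
    have aux : ∀ s, s = 0 → ∀ D (h : C s = D) (h' : D = C 0) (x : Red D),
        redCast h (H s (redCast h' x)) = x := by
      rintro s rfl D rfl h' x
      rw [hH.start, LinearMap.id_apply, redCast_rfl, redCast_rfl]
    refine LinearMap.ext fun x => ?_
    have h : (0 : ℝ) ≤ 1 / 2 := by norm_num
    simp only [twiceRed, dif_pos h, LinearMap.comp_apply]
    exact aux (2 * 0) (mul_zero 2) _ _ _ x

end Twice

/-- For a loop `C` of coisotropic subspaces and a path `H` of symplectic maps of the reduced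
spaces: lifts exist, each lift has a mean index, `-Δ(Ψ)` is the same number for all lifts
`Ψ`, and the Maslov index (including the case of a non-oriented loop) has exactly one value. -/
theorem mainTheorem3 (n : ℕ) (C : ℝ → Submodule ℝ (Vec n))
    (H : ∀ t : ℝ, Red (C 0) →ₗ[ℝ] Red (C t))
    (hC : IsCoisotropicLoop C) (hH : IsReducedPath C H) :
    (∃ Ψ, IsLift C H Ψ) ∧
    (∃ m : ℝ, ∀ Ψ, IsLift C H Ψ → ∀ d : ℝ, HasMeanIndex Ψ d ↔ -d = m) ∧
    (∃! m : ℝ, IsMaslovIndex C hC.closed H m) := by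
  -- stated for all loops, as the loop traversed twice needs it too
  have key : ∀ {C : ℝ → Submodule ℝ (Vec n)} {H : ∀ t : ℝ, Red (C 0) →ₗ[ℝ] Red (C t)},
      IsCoisotropicLoop C → IsReducedPath C H → (∃ Ψ, IsLift C H Ψ) ∧
        ∃ m : ℝ, ∀ Ψ, IsLift C H Ψ → ∀ d : ℝ, HasMeanIndex Ψ d ↔ -d = m := by
    intro C H hC hH
    obtain ⟨Ψ₀, hΨ₀⟩ := exists_isLift hC hH
    have h0 := hC.coisotropic 0 ⟨le_rfl, zero_le_one⟩
    obtain ⟨d₀, hd₀, -⟩ := hΨ₀.exists_common_meanIndex h0 hC.closed hΨ₀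
    refine ⟨⟨Ψ₀, hΨ₀⟩, -d₀, fun Ψ hΨ d => ?_⟩
    obtain ⟨d₁, h₁, h₁'⟩ := hΨ₀.exists_common_meanIndex h0 hC.closed hΨ
    obtain rfl := h₁.unique hd₀
    rw [neg_inj]
    exact ⟨fun h => h.unique h₁', fun h => h ▸ h₁'⟩
  -- for an oriented loop the index has exactly one value
  have unique_value : ∀ {C : ℝ → Submodule ℝ (Vec n)} {H : ∀ t : ℝ, Red (C 0) →ₗ[ℝ] Red (C t)},
      IsCoisotropicLoop C → IsReducedPath C H → IsOriented C →
        ∃ m : ℝ, ∀ m', IsOrientedMaslovIndex C H m' ↔ m' = m := by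
    intro C H hC hH ho
    obtain ⟨⟨Ψ₀, hΨ₀⟩, m, hm⟩ := key hC hH
    refine ⟨m, fun m' => ⟨?_, ?_⟩⟩
    · rintro ⟨-, Ψ, hΨ, h⟩
      rw [← (hm Ψ hΨ _).1 h, neg_neg]
    · rintro rfl
      exact ⟨ho, Ψ₀, hΨ₀, (hm Ψ₀ hΨ₀ _).2 (neg_neg _)⟩
  refine ⟨(key hC hH).1, (key hC hH).2, ?_⟩
  by_cases ho : IsOriented C
  · obtain ⟨m, hm⟩ := unique_value hC hH ho
    simp only [IsMaslovIndex, ho, not_true_eq_false, false_and, or_false, hm]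
    exact ⟨m, rfl, fun _ h => h⟩
  · obtain ⟨m, hm⟩ := unique_value (isCoisotropicLoop_twice hC) (isReducedPath_twiceRed hC hH)
      (isOriented_twice hC)
    have hn : ∀ m', ¬ IsOrientedMaslovIndex C H m' := fun m' h => ho h.1
    simp only [IsMaslovIndex, ho, hn, not_false_eq_true, true_and, false_or, hm]
    exact ⟨m / 2, by ring, fun m' h => by linarith⟩
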